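/- Let $n\ge 3$ and let $E(x)=|x|^{2-n}/\big(n(n-2)b_1(n)\big)$ be the fundamental solution of $-\Delta$ in $\mathbf{R}^n$, where $b_1(n)$ is the volume of the unit ball. **(Perturbed half space.)** Let $h\in C^2_{\mathrm c}(\mathbf{R}^{n-1})$, $h\not\equiv 0$, let $\mathbf{R}^n_h=\{(x',x_n)\in\mathbf{R}^n : x_n>h(x')\}$ and $\Gamma=\partial\mathbf{R}^n_h$. Let $\dot H^{1/2}(\Gamma)$ be the space of all $f\in L^{\frac{2n-2}{n-2}}(\Gamma)$ with $$\|f\|_{\dot H^{1/2}(\Gamma)}^2=\int_\Gamma\int_\Gamma\frac{|f(x)-f(y)|^2}{|x-y|^n}\,d\mathcal H^{n-1}(x)\,d\mathcal H^{n-1}(y)<\infty,$$ let $\dot H^{-1/2}(\Gamma)$ be its dual space with the dual norm, let $L^\infty(\Gamma)\cap\dot H^{-1/2}(\Gamma)$ consist of the $g\in L^\infty(\Gamma)$ that represent an element of $\dot H^{-1/2}(\Gamma)$ through $f\mapsto\int_\Gamma gf\,d\mathcal H^{n-1}$, and put $\|g\|_{L^\infty(\Gamma)\cap\dot H^{-1/2}(\Gamma)}=\max\big(\|g\|_{L^\infty(\Gamma)},\|g\|_{\dot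 H^{-1/2}(\Gamma)}\big)$. For $x\notin\Gamma$ let $\nabla E*(\delta_\Gamma\otimes g)(x)=\int_\Gamma\nabla E(x-y)g(y)\,d\mathcal H^{n-1}(y)$, understood componentwise as the duality pairing of $g$ with $\partial_jE(x-\cdot)\in\dot H^{1/2}(\Gamma)$. Let $R_h$ be the smallest radius with $\operatorname{supp}h\subseteq\overline{B_{R_h}(0')}$, $C_s(h)=1+\|h\|_{C^1(\mathbf{R}^{n-1})}$ and $C_1(h)=1+R_h\|\nabla'^2h\|_{L^\infty(\mathbf{R}^{n-1})}$. Then there is a constant $C(n)>0$ depending only on $n$ such that for all such $h$, all $\rho_0>0$ (in particular for every admissible radius of the normal coordinate charts of $\Gamma$) and all $g\in L^\infty(\Gamma)\cap\dot H^{-1/2}(\Gamma)$ one has $\nabla E*(\delta_\Gamma\otimes g)\in L^2(\mathbf{R}^n)$ and $$\big\|\nabla E*(\delta_\Gamma\otimes g)\big\|_{L^2(\mathbf{R}^n)}\le C(n)\,C(h,\rho_0)\,\|g\|_{L^\infty(\Gamma)\cap\dot H^{-1/2}(\Gamma)},$$ where $$C(h,\rho_0)=\rho_0^{\frac12}R_h^{\frac{n-1}2}+\rho_0^{\frac{n+2}{2n}}C_s(h)^2R_h^{\frac{n^2+n-2}{2n}}\big(\|\nabla'^2h\|_{L^\infty(\mathbf{R}^{n-1})}+\rho_0^{-1}\big)+C_s(h)^{n+5}C_1(h)^2\big(1+R_h^{\frac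 n2}\big).$$ **(Flat case.)** Let $\dot H^{-1/2}(\mathbf{R}^{n-1})$ be the space of tempered distributions $g$ with $\widehat g\in L^1_{loc}(\mathbf{R}^{n-1})$ and $\|g\|_{\dot H^{-1/2}(\mathbf{R}^{n-1})}^2=\int_{\mathbf{R}^{n-1}}|\xi'|^{-1}|\widehat g(\xi')|^2\,d\xi'<\infty$. For $x$ in $\mathbf{R}^n_+=\{x_n>0\}$ let the $j$-th component of $\nabla E*(\delta_{\partial\mathbf{R}^n_+}\otimes g)(x)$ be the duality pairing of $g$ with the function $y'\mapsto\partial_jE(x-(y',0))$. Then there is a constant $C(n)>0$ depending only on $n$ such that for every $g\in\dot H^{-1/2}(\mathbf{R}^{n-1})$ $$\big\|\nabla E*(\delta_{\partial\mathbf{R}^n_+}\otimes g)\big\|_{L^2(\mathbf{R}^n_+)}=C(n)\,\|g\|_{\dot H^{-1/2}(\mathbf{R}^{n-1})}.$$ -/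

import Mathlib

open MeasureTheory FourierTransform
open scoped ENNReal SchwartzMap

noncomputable section

/-- `ℝᵏ` with its Euclidean norm. Throughout, `n = d + 1`, so `ℝⁿ = R (d + 1)`, `ℝⁿ⁻¹ = R d`. -/
abbrev R (k : ℕ) := EuclideanSpace ℝ (Fin k)

/-- The point `(y', t)` of `ℝⁿ`. -/
def point {d : ℕ} (y : R d) (t : ℝ) : R (d + 1) :=
  WithLp.toLp 2 (Fin.snoc (α := fun _ => ℝ) (fun i => y i) t)

/-- The first `n - 1` coordinates `x'` of `x = (x', xₙ)`. -/
def horizontal {d : ℕ} (x : R (d + 1)) : R d :=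
  WithLp.toLp 2 (fun i => x (Fin.castSucc i))

/-- The last coordinate `xₙ` of `x = (x', xₙ)`. -/
def vertical {d : ℕ} (x : R (d + 1)) : ℝ := x (Fin.last d)

/-- The perturbed half space `{x | xₙ > h(x')}`. -/
def perturbedHalfSpace {d : ℕ} (h : R d → ℝ) : Set (R (d + 1)) :=
  {x | h (horizontal x) < vertical x}

/-- The boundary `Γ` of the perturbed half space. -/
def boundary {d : ℕ} (h : R d → ℝ) : Set (R (d + 1)) :=
  frontier (perturbedHalfSpace h)

/-- The flat half space `{x | xₙ > 0}`. -/
def halfSpace (d : ℕ) : Set (R (d + 1)) := {x | 0 < vertical x}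

/-- The surface measure on `Γ`: the `(n - 1)`-dimensional Hausdorff measure (normalised to agree
with Lebesgue measure on Euclidean `(n - 1)`-space) restricted to `Γ`. -/
def surface {d : ℕ} (h : R d → ℝ) : Measure (R (d + 1)) :=
  (Measure.euclideanHausdorffMeasure d).restrict (boundary h)

/-- The fundamental solution `E(x) = |x|^{2-n} / (n (n-2) b₁(n))` of `-Δ` in `ℝⁿ`, `n ≥ 3`, with
`b₁(n)` the volume of the unit ball. -/
def fundSol (n : ℕ) (x : R n) : ℝ :=
  ‖x‖ ^ (2 - (n : ℤ)) / (n * (n - 2) * volume.real (Metric.ball (0 : R n) 1))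

/-- `y ↦ ∂ⱼE(x - y)`, as a complex-valued function. -/
def gradKernel {n : ℕ} (x : R n) (j : Fin n) (y : R n) : ℂ :=
  ((gradient (fundSol n) (x - y) j : ℝ) : ℂ)

/-! ### The spaces `Ḣ^{1/2}(Γ)` and `Ḣ^{-1/2}(Γ)` -/

/-- The quotient `(f(x) - f(y)) / |x - y|^{n/2}`, whose `L²(Γ × Γ)` norm is the Gagliardo norm. -/
def gagliardoQuot {n : ℕ} (f : R n → ℂ) (p : R n × R n) : ℂ :=
  (f p.1 - f p.2) / ((‖p.1 - p.2‖ ^ ((n : ℝ) / 2) : ℝ) : ℂ)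

/-- `Ḣ^{1/2}(Γ)`: the functions in `L^{(2n-2)/(n-2)}(Γ)` whose Gagliardo norm is finite. -/
def hHalfSubmodule {d : ℕ} (h : R d → ℝ) : Submodule ℂ (R (d + 1) → ℂ) where
  carrier := {f | MemLp f (ENNReal.ofReal (2 * d / (d - 1))) (surface h) ∧
    MemLp (gagliardoQuot f) 2 ((surface h).prod (surface h))}
  zero_mem' := by
    refine ⟨MemLp.zero, ?_⟩
    have : gagliardoQuot (0 : R (d + 1) → ℂ) = 0 := by ext p; simp [gagliardoQuot]
    rw [this]; exact MemLp.zero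
  add_mem' := by
    rintro f g ⟨hf, hf'⟩ ⟨hg, hg'⟩
    refine ⟨hf.add hg, ?_⟩
    have : gagliardoQuot (f + g) = gagliardoQuot f + gagliardoQuot g := by
      ext p; simp only [gagliardoQuot, Pi.add_apply]; ring
    rw [this]; exact hf'.add hg'
  smul_mem' := by
    rintro c f ⟨hf, hf'⟩
    refine ⟨hf.const_smul c, ?_⟩
    have : gagliardoQuot (c • f) = c • gagliardoQuot f := by
      ext p; simp only [gagliardoQuot, Pi.smul_apply, smul_eq_mul]; ring
    rw [this]; exact hf'.const_smul c

/-- `Ḣ^{1/2}(Γ)` as a (semi)normed space: functions are not identified when they agree almost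
everywhere, which does not change the dual space. -/
def HHalf {d : ℕ} (h : R d → ℝ) : Type := hHalfSubmodule h

namespace HHalf

variable {d : ℕ} (h : R d → ℝ)

instance : AddCommGroup (HHalf h) := inferInstanceAs (AddCommGroup (hHalfSubmodule h))

instance : Module ℂ (HHalf h) := inferInstanceAs (Module ℂ (hHalfSubmodule h))

/-- The difference quotient as an element of `L²(Γ × Γ)`. -/
def toL2 : HHalf h →ₗ[ℂ] Lp ℂ 2 ((surface h).prod (surface h)) where
  toFun f := f.2.2.toLp (gagliardoQuot f.1)
  map_add' f g := by
    rw [← MemLp.toLp_add]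
    refine MemLp.toLp_congr _ _ (Filter.Eventually.of_forall fun p => ?_)
    change ((f.1 p.1 + g.1 p.1) - (f.1 p.2 + g.1 p.2)) / _ =
      (f.1 p.1 - f.1 p.2) / _ + (g.1 p.1 - g.1 p.2) / _
    ring
  map_smul' c f := by
    rw [RingHom.id_apply, ← MemLp.toLp_const_smul]
    refine MemLp.toLp_congr _ _ (Filter.Eventually.of_forall fun p => ?_)
    change (c * f.1 p.1 - c * f.1 p.2) / _ = c * ((f.1 p.1 - f.1 p.2) / _)
    ring

/-- `‖f‖² = ∫_Γ ∫_Γ |f(x) - f(y)|² / |x - y|ⁿ`. -/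
instance : SeminormedAddCommGroup (HHalf h) :=
  SeminormedAddCommGroup.induced (HHalf h) (Lp ℂ 2 ((surface h).prod (surface h))) (toL2 h)

instance : NormedSpace ℂ (HHalf h) :=
  NormedSpace.induced ℂ (HHalf h) (Lp ℂ 2 ((surface h).prod (surface h))) (toL2 h)

end HHalf

/-- `Ḣ^{-1/2}(Γ)`: the dual space of `Ḣ^{1/2}(Γ)`, with the dual norm. -/
abbrev HMinusHalf {d : ℕ} (h : R d → ℝ) := HHalf h →L[ℂ] ℂ

/-- `L^∞(Γ) ∩ Ḣ^{-1/2}(Γ)`: a function `g ∈ L^∞(Γ)` together with the element of `Ḣ^{-1/2}(Γ)`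
that it represents, i.e. the functional that is `f ↦ ∫_Γ g f` wherever this integral exists. -/
structure LinftyHMinusHalf {d : ℕ} (h : R d → ℝ) where
  toFun : R (d + 1) → ℂ
  memLp_top : MemLp toFun ∞ (surface h)
  toDual : HMinusHalf h
  toDual_eq : ∀ f : HHalf h, Integrable (fun y => toFun y * f.1 y) (surface h) →
    toDual f = ∫ y, toFun y * f.1 y ∂(surface h)

/-- The norm of `L^∞(Γ) ∩ Ḣ^{-1/2}(Γ)`. -/
def LinftyHMinusHalf.norm {d : ℕ} {h : R d → ℝ} (g : LinftyHMinusHalf h) : ℝ :=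
  max (eLpNorm g.toFun ∞ (surface h)).toReal ‖g.toDual‖

open Classical in
/-- `∇E * (δ_Γ ⊗ g)` at `x ∉ Γ`: the `j`-th component is the pairing `∫_Γ ∂ⱼE(x - y) g(y) dℋⁿ⁻¹(y)`
of `g` with `∂ⱼE(x - ·) ∈ Ḣ^{1/2}(Γ)` (the integral need not converge absolutely). -/
def gradSingleLayer {d : ℕ} {h : R d → ℝ} (g : LinftyHMinusHalf h) (x : R (d + 1)) :
    EuclideanSpace ℂ (Fin (d + 1)) :=
  WithLp.toLp 2 fun j =>
    if hk : gradKernel x j ∈ hHalfSubmodule h then g.toDual ⟨gradKernel x j, hk⟩ else 0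

/-! ### The constant -/

/-- `R_h`: the smallest radius with `supp h ⊆ closedBall 0 R_h`. -/
def supportRadius {d : ℕ} (h : R d → ℝ) : ℝ :=
  sInf {r : ℝ | 0 < r ∧ tsupport h ⊆ Metric.closedBall 0 r}

/-- `C_s(h) = 1 + ‖h‖_{C¹}`. -/
def Cs {d : ℕ} (h : R d → ℝ) : ℝ := 1 + ((⨆ y, |h y|) + ⨆ y, ‖fderiv ℝ h y‖)

/-- `‖∇'²h‖_{L^∞}`. -/
def hessSup {d : ℕ} (h : R d → ℝ) : ℝ := ⨆ y, ‖iteratedFDeriv ℝ 2 h y‖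

/-- `C₁(h) = 1 + R_h ‖∇'²h‖_{L^∞}`. -/
def C1 {d : ℕ} (h : R d → ℝ) : ℝ := 1 + supportRadius h * hessSup h

/-- The constant `C(h, ρ₀)`, with `n = d + 1`. -/
def layerConst {d : ℕ} (h : R d → ℝ) (ρ₀ : ℝ) : ℝ :=
  let n : ℝ := d + 1
  ρ₀ ^ ((1 : ℝ) / 2) * supportRadius h ^ ((n - 1) / 2)
    + ρ₀ ^ ((n + 2) / (2 * n)) * Cs h ^ 2 * supportRadius h ^ ((n ^ 2 + n - 2) / (2 * n))
      * (hessSup h + ρ₀⁻¹)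
    + Cs h ^ (n + 5) * C1 h ^ 2 * (1 + supportRadius h ^ (n / 2))

/-! ### The flat case -/

/-- The homogeneous Sobolev space `Ḣˢ(ℝᵈ)`: tempered distributions whose Fourier transform is a
locally integrable function `fourier` with `∫ |ξ|^{2s} |fourier ξ|² dξ < ∞`. -/
structure HomSobolev (d : ℕ) (s : ℝ) where
  toDistribution : 𝓢'(R d, ℂ)
  fourier : R d → ℂ
  locallyIntegrable : LocallyIntegrable fourier
  fourier_eq : ∀ φ : 𝓢(R d, ℂ), HasCompactSupport φ →
    (𝓕 toDistribution) φ = ∫ ξ, fourier ξ * φ ξ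
  memLp_two : MemLp (fun ξ => ((‖ξ‖ ^ s : ℝ) : ℂ) * fourier ξ) 2 volume

/-- `‖g‖_{Ḣˢ} = (∫ |ξ|^{2s} |ĝ(ξ)|² dξ)^{1/2}`. -/
def HomSobolev.norm {d : ℕ} {s : ℝ} (g : HomSobolev d s) : ℝ :=
  (eLpNorm (fun ξ => ((‖ξ‖ ^ s : ℝ) : ℂ) * g.fourier ξ) 2 volume).toReal

/-- The integrand of the duality pairing `⟨g, f⟩ = ∫ ĝ(ξ) (𝓕⁻¹f)(ξ) dξ` of `g` with
`f ∈ L²(ℝᵈ)`. -/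
def HomSobolev.pairIntegrand {d : ℕ} {s : ℝ} (g : HomSobolev d s) {f : R d → ℂ}
    (hf : MemLp f 2 volume) (ξ : R d) : ℂ :=
  g.fourier ξ * (𝓕⁻ (hf.toLp f : Lp ℂ 2 (volume : Measure (R d))) : Lp ℂ 2 (volume : Measure (R d))) ξ

open Classical in
/-- `∇E * (δ_{∂ℝⁿ₊} ⊗ g)` at `x ∈ ℝⁿ₊` for `g ∈ Ḣ^{-1/2}(ℝⁿ⁻¹)`: the `j`-th component is the
pairing of `g` with `y' ↦ ∂ⱼE(x - (y', 0))`. -/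
def gradSingleLayerFlat {d : ℕ} (g : HomSobolev d (-(1 / 2))) (x : R (d + 1)) :
    EuclideanSpace ℂ (Fin (d + 1)) :=
  WithLp.toLp 2 fun j =>
    if hk : MemLp (fun y : R d => gradKernel x j (point y 0)) 2 volume then
      ∫ ξ, g.pairIntegrand hk ξ else 0

end

/-! Write `d = n - 1`. Perturbed half space. The norm of `Ḣ^{1/2}(Γ)` is the `L²(Γ × Γ)` norm of the
Gagliardo quotient, so by Hahn–Banach and Riesz the functional `g` is the inner product with some `G
∈ L²(Γ × Γ)`, `‖G‖ ≤ ‖g‖` (`exists_inner_representative`). Inserting `f = ∂ⱼE(x - ·)` turns the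
layer potential into an integral operator acting on `G`. Since `∇E` is a multiple of `u /
|u|^{d+1}`, its kernel at `w = (y, z)` is dominated by a multiple of `|y - z|^{-(d+1)/2}` times the
sum over `A ∈ {|x - y|, |x - z|}` of `A^{-d} min(1, |y - z| / A)` (`norm_inv_pow_smul_sub_le`,
`exists_gradKernel_le`).

That positive operator is bounded from `L²(Γ × Γ)` to `L²(ℝⁿ)` by the Schur test with weights `p(x)
= |xₙ - h(x')|^{-1/2}` and `q(y, z) = |y - z|^{-d/2}` (`schur_test`,
`exists_lintegral_schurKernel_le`). The geometry of `Γ` enters through its Lipschitz constant: the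
area factor costs `Cs h ^ d` per surface integral, and comparing the distance to `Γ` with the
vertical distance costs further factors `Cs h`. The operator norm is at most `C(n) Cs(h)^{d+1}`,
which the last summand of `layerConst` dominates.

Flat case. For `xₙ > 0`, subordinating the Poisson semigroup to Gaussians gives `E(x) = c ∫ |ξ|⁻¹
e^{2πi⟨ξ,x'⟩ - 2π xₙ|ξ|} dξ` (`exists_fundSol_eq_integral_poissonWave`). Differentiating shows that
the trace of `∂ⱼE(x - ·)` is the Fourier transform of an explicit function, so the potential at
height `t` is the inverse Fourier transform of `c σⱼ(ξ) e^{-2πt|ξ|} ĝ(ξ)`, where `σⱼ` is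
`waveSymbol` in the `j`-th coordinate direction. Plancherel on each horizontal slice, the identity
`∑ⱼ |σⱼ|² = 8π²` and `∫₀^∞ e^{-4πt|ξ|} dt = 1 / (4π|ξ|)` produce exactly `2π c² ∫ |ξ|⁻¹ |ĝ|²`. -/

noncomputable section

/-! ### Coordinates on `ℝᵈ⁺¹` -/

@[simp] lemma horizontal_point {d : ℕ} (y : R d) (t : ℝ) : horizontal (point y t) = y := by
  ext i; simp [horizontal, point]

@[simp] lemma vertical_point {d : ℕ} (y : R d) (t : ℝ) : vertical (point y t) = t := by
  simp [vertical, point]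

@[simp] lemma point_horizontal_vertical {d : ℕ} (x : R (d + 1)) :
    point (horizontal x) (vertical x) = x := by
  ext i; refine Fin.lastCases ?_ (fun i => ?_) i <;> simp [horizontal, point, vertical]

lemma norm_sq_eq_horizontal_vertical {d : ℕ} (x : R (d + 1)) :
    ‖x‖ ^ 2 = ‖horizontal x‖ ^ 2 + vertical x ^ 2 := by
  simp [EuclideanSpace.norm_sq_eq, Fin.sum_univ_castSucc, horizontal, vertical]

lemma norm_horizontal_le {d : ℕ} (x : R (d + 1)) : ‖horizontal x‖ ≤ ‖x‖ := by
  refine abs_le_of_sq_le_sq' ?_ (norm_nonneg _) |>.2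
  rw [norm_sq_eq_horizontal_vertical x]; nlinarith [sq_nonneg (vertical x)]

lemma abs_vertical_le {d : ℕ} (x : R (d + 1)) : |vertical x| ≤ ‖x‖ := by
  refine abs_le_of_sq_le_sq ?_ (norm_nonneg _)
  rw [norm_sq_eq_horizontal_vertical x]; nlinarith [sq_nonneg ‖horizontal x‖]

lemma norm_le_horizontal_add_vertical {d : ℕ} (x : R (d + 1)) :
    ‖x‖ ≤ ‖horizontal x‖ + |vertical x| := by
  refine abs_le_of_sq_le_sq' ?_ (by positivity) |>.2
  rw [norm_sq_eq_horizontal_vertical x, add_sq, sq_abs]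
  have := mul_nonneg (norm_nonneg (horizontal x)) (abs_nonneg (vertical x))
  linarith

lemma horizontal_sub {d : ℕ} (x y : R (d + 1)) :
    horizontal (x - y) = horizontal x - horizontal y := by
  ext i; simp [horizontal]

lemma vertical_sub {d : ℕ} (x y : R (d + 1)) : vertical (x - y) = vertical x - vertical y := by
  simp [vertical]

lemma continuous_horizontal {d : ℕ} : Continuous (horizontal : R (d + 1) → R d) := by
  unfold horizontal; fun_prop

lemma continuous_vertical {d : ℕ} : Continuous (vertical : R (d + 1) → ℝ) := by
  unfold vertical; fun_prop

lemma continuous_point {d : ℕ} : Continuous (fun p : R d × ℝ => point p.1 p.2) := by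
  unfold point
  refine (PiLp.continuous_toLp 2 _).comp (continuous_pi fun i => ?_)
  refine Fin.lastCases ?_ (fun i => ?_) i <;> simp <;> fun_prop

lemma measurePreserving_point (d : ℕ) :
    MeasurePreserving (fun p : R d × ℝ => point p.1 p.2) := by
  have h1 : MeasurePreserving (Prod.map (WithLp.ofLp : R d → _) (id : ℝ → ℝ)) :=
    (PiLp.volume_preserving_ofLp (Fin d)).prod (MeasurePreserving.id _)
  have h2 : MeasurePreserving (Prod.swap : (Fin d → ℝ) × ℝ → ℝ × (Fin d → ℝ)) :=
    Measure.measurePreserving_swap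
  have h3 := (volume_preserving_piFinSuccAbove (fun _ : Fin (d + 1) => ℝ) (Fin.last d)).symm _
  have h4 := PiLp.volume_preserving_toLp (Fin (d + 1))
  have := h4.comp (h3.comp (h2.comp h1))
  convert this using 1
  ext p i
  refine Fin.lastCases ?_ (fun i => ?_) i <;>
    simp [point, MeasurableEquiv.piFinSuccAbove, Fin.insertNthEquiv]

lemma lintegral_eq_lintegral_point {d : ℕ} {f : R (d + 1) → ℝ≥0∞} (hf : Measurable f) :
    ∫⁻ x, f x = ∫⁻ y : R d, ∫⁻ t : ℝ, f (point y t) := by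
  rw [← (measurePreserving_point d).lintegral_comp hf, Measure.volume_eq_prod,
    lintegral_prod (fun p : R d × ℝ => f (point p.1 p.2))
      (hf.comp continuous_point.measurable).aemeasurable]

/-! ### The graph of `h` -/

lemma vertical_eq_of_mem_boundary {d : ℕ} {h : R d → ℝ} (hh : Continuous h) {x : R (d + 1)}
    (hx : x ∈ boundary h) : vertical x = h (horizontal x) :=
  (frontier_lt_subset_eq (hh.comp continuous_horizontal) continuous_vertical hx).symm

/-- This inclusion is enough, because integrals over `Γ` are only ever bounded from above. -/
lemma boundary_subset_range {d : ℕ} {h : R d → ℝ} (hh : Continuous h) :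
    boundary h ⊆ Set.range fun y => point y (h y) := fun x hx =>
  ⟨horizontal x, by simp [← vertical_eq_of_mem_boundary hh hx]⟩

lemma ae_vertical_ne {d : ℕ} {h : R d → ℝ} (hh : Continuous h) :
    ∀ᵐ x : R (d + 1), vertical x ≠ h (horizontal x) := by
  have hm : MeasurableSet {x : R (d + 1) | vertical x = h (horizontal x)} :=
    (isClosed_eq continuous_vertical (hh.comp continuous_horizontal)).measurableSet
  have : volume {x : R (d + 1) | vertical x = h (horizontal x)} = 0 := by
    rw [← lintegral_indicator_one hm, lintegral_eq_lintegral_point (measurable_one.indicator hm)]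
    refine (lintegral_congr fun y => ?_).trans lintegral_zero
    rw [lintegral_congr_ae (g := 0)]
    · simp
    · filter_upwards [Measure.ae_ne volume (h y)] with t ht
      simp [ht]
  simpa [ae_iff] using this

lemma volume_boundary {d : ℕ} {h : R d → ℝ} (hh : Continuous h) : volume (boundary h) = 0 := by
  refine measure_mono_null (fun x hx => ?_) (ae_iff.1 (ae_vertical_ne hh))
  simpa using vertical_eq_of_mem_boundary hh hx

lemma norm_fderiv_le_Cs {d : ℕ} {h : R d → ℝ} (hh : ContDiff ℝ 2 h) (hc : HasCompactSupport h)
    (y : R d) : 1 + ‖fderiv ℝ h y‖ ≤ Cs h := by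
  have hcont : Continuous (fderiv ℝ h) := hh.continuous_fderiv (by norm_num)
  have h1 : BddAbove (Set.range fun y => ‖fderiv ℝ h y‖) :=
    (hcont.norm.bddAbove_range_of_hasCompactSupport (hc.fderiv ℝ).norm)
  have h2 := le_ciSup h1 y
  have h3 : 0 ≤ ⨆ y, |h y| := Real.iSup_nonneg fun y => abs_nonneg _
  unfold Cs; linarith

/-- The summand `1` in `Cs h` is kept in reserve: it pays for the horizontal displacement, so that
the graph map itself is `Cs h`-Lipschitz. -/
lemma abs_sub_le_Cs {d : ℕ} {h : R d → ℝ} (hh : ContDiff ℝ 2 h) (hc : HasCompactSupport h)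
    (y z : R d) : |h y - h z| ≤ (Cs h - 1) * ‖y - z‖ := by
  have := convex_univ.norm_image_sub_le_of_norm_fderiv_le (𝕜 := ℝ) (f := h) (C := Cs h - 1)
    (fun x _ => (hh.differentiable (by norm_num)) x)
    (fun x _ => by linarith [norm_fderiv_le_Cs hh hc x]) (Set.mem_univ z) (Set.mem_univ y)
  simpa using this

lemma one_le_Cs {d : ℕ} (h : R d → ℝ) : 1 ≤ Cs h := by
  have h1 : 0 ≤ ⨆ y, |h y| := Real.iSup_nonneg fun y => abs_nonneg _
  have h2 : 0 ≤ ⨆ y, ‖fderiv ℝ h y‖ := Real.iSup_nonneg fun y => norm_nonneg _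
  unfold Cs; linarith

lemma lipschitzWith_graph {d : ℕ} {h : R d → ℝ} (hh : ContDiff ℝ 2 h) (hc : HasCompactSupport h) :
    LipschitzWith (Cs h).toNNReal fun y => point y (h y) := by
  refine LipschitzWith.of_dist_le_mul fun y z => ?_
  rw [dist_eq_norm, dist_eq_norm, Real.coe_toNNReal _ (by linarith [one_le_Cs h])]
  refine (norm_le_horizontal_add_vertical _).trans ?_
  have := abs_sub_le_Cs hh hc y z
  simp only [horizontal_sub, vertical_sub, horizontal_point, vertical_point]
  linarith

/-- The surface measure is dominated by the image of Lebesgue measure under the graph map. -/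
lemma surface_le {d : ℕ} {h : R d → ℝ} (hh : ContDiff ℝ 2 h) (hc : HasCompactSupport h) :
    surface h ≤ ENNReal.ofReal (Cs h ^ d) • volume.map fun y => point y (h y) := by
  refine Measure.le_iff.2 fun s hs => ?_
  have hgc : Continuous fun y => point y (h y) := (lipschitzWith_graph hh hc).continuous
  have hsub : s ∩ boundary h ⊆
      (fun y => point y (h y)) '' ((fun y => point y (h y)) ⁻¹' s) := by
    rintro x ⟨hxs, hx⟩
    obtain ⟨y, rfl⟩ := boundary_subset_range hh.continuous hx
    exact ⟨y, hxs, rfl⟩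
  rw [surface, Measure.restrict_apply hs, Measure.smul_apply, Measure.map_apply hgc.measurable hs,
    ← EuclideanSpace.euclideanHausdorffMeasure_eq_volume]
  refine (measure_mono hsub).trans ?_
  simp only [Measure.euclideanHausdorffMeasure_def, Measure.smul_apply]
  have := (lipschitzWith_graph hh hc).hausdorffMeasure_image_le (Nat.cast_nonneg d)
    ((fun y => point y (h y)) ⁻¹' s)
  rw [ENNReal.rpow_natCast] at this
  rw [ENNReal.ofReal_pow (by linarith [one_le_Cs h])]
  simp only [ENNReal.smul_def, smul_eq_mul]
  rw [mul_left_comm]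
  exact mul_le_mul_right this _

/-- Needed for product measures and Tonelli on `Γ × Γ`. A finite multiple of the image of Lebesgue
measure under the injective graph map dominates the surface measure. -/
lemma sigmaFinite_surface {d : ℕ} {h : R d → ℝ} (hh : ContDiff ℝ 2 h) (hc : HasCompactSupport h) :
    SigmaFinite (surface h) := by
  have hg : MeasurableEmbedding fun y => point y (h y) := by
    refine Continuous.measurableEmbedding (lipschitzWith_graph hh hc).continuous fun y z hyz => ?_
    simpa using congrArg horizontal hyz
  have := hg.sigmaFinite_map (μ := volume)
  have : SigmaFinite (ENNReal.ofReal (Cs h ^ d) • volume.map fun y => point y (h y)) := by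
    exact inferInstanceAs (SigmaFinite ((Cs h ^ d).toNNReal • _))
  exact Measure.sigmaFinite_of_le _ (surface_le hh hc)

lemma lintegral_surface_le {d : ℕ} {h : R d → ℝ} (hh : ContDiff ℝ 2 h) (hc : HasCompactSupport h)
    {f : R (d + 1) → ℝ≥0∞} (hf : Measurable f) :
    ∫⁻ y, f y ∂surface h ≤ ENNReal.ofReal (Cs h ^ d) * ∫⁻ y, f (point y (h y)) := by
  refine (lintegral_mono' (surface_le hh hc) le_rfl).trans ?_
  rw [lintegral_smul_measure, smul_eq_mul,
    lintegral_map hf (lipschitzWith_graph hh hc).continuous.measurable]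

lemma ae_surface_mem_boundary {d : ℕ} (h : R d → ℝ) : ∀ᵐ y ∂surface h, y ∈ boundary h :=
  ae_restrict_mem isClosed_frontier.measurableSet

/-- The distance to a point of the graph controls the vertical distance to the graph. -/
lemma abs_vertical_sub_le {d : ℕ} {h : R d → ℝ} (hh : ContDiff ℝ 2 h) (hc : HasCompactSupport h)
    (x : R (d + 1)) (y : R d) : |vertical x - h (horizontal x)| ≤ Cs h * ‖x - point y (h y)‖ := by
  have h1 := abs_sub_le_Cs hh hc (horizontal x) y
  have h2 := norm_horizontal_le (x - point y (h y))
  have h3 := abs_vertical_le (x - point y (h y))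
  rw [horizontal_sub, horizontal_point] at h2
  rw [vertical_sub, vertical_point] at h3
  have h4 := mul_le_mul_of_nonneg_left h2 (by linarith [one_le_Cs h] : 0 ≤ Cs h - 1)
  have h5 := abs_sub_le (vertical x) (h y) (h (horizontal x))
  rw [abs_sub_comm (h y)] at h5
  linarith

lemma norm_horizontal_sub_le {d : ℕ} (x : R (d + 1)) (y : R d) (t : ℝ) :
    ‖horizontal x - y‖ ≤ ‖x - point y t‖ := by
  simpa [horizontal_sub] using norm_horizontal_le (x - point y t)

/-! ### Radial integrals -/

/-- A radial function, homogeneous of degree `-k` jointly in `s` and the scale `l`, whose integral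
over a `k`-dimensional space is finite and does not depend on the scale. -/
def scaleProfile (k : ℕ) (α β l s : ℝ) : ℝ := (s ^ k)⁻¹ * min ((s / l) ^ α) ((s / l) ^ (-β))

lemma scaleProfile_nonneg (k : ℕ) (α β : ℝ) {l s : ℝ} (hl : 0 ≤ l) (hs : 0 ≤ s) :
    0 ≤ scaleProfile k α β l s := by
  unfold scaleProfile; positivity

/-- Polar coordinates cancel the factor `s⁻ᵏ` up to `1/s`, leaving `∫ y⁻¹ min(y^α, y^{-β}) dy`: `α >
0` gives convergence at `0`, `β > 0` at infinity. -/
lemma integrable_scaleProfile_one {E : Type*} [NormedAddCommGroup E] [NormedSpace ℝ E]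
    [FiniteDimensional ℝ E] [Nontrivial E] [MeasurableSpace E] [BorelSpace E] (μ : Measure E)
    [μ.IsAddHaarMeasure] {α β : ℝ} (hα : 0 < α) (hβ : 0 < β) :
    Integrable (fun z : E => scaleProfile (Module.finrank ℝ E) α β 1 ‖z‖) μ := by
  rw [integrable_fun_norm_addHaar μ (f := scaleProfile (Module.finrank ℝ E) α β 1)]
  have hk : 0 < Module.finrank ℝ E := Module.finrank_pos
  have hm : Measurable fun y : ℝ => y ^ (Module.finrank ℝ E - 1) •
      scaleProfile (Module.finrank ℝ E) α β 1 y := by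
    unfold scaleProfile; fun_prop
  have key : ∀ y : ℝ, 0 < y → y ^ (Module.finrank ℝ E - 1) •
      scaleProfile (Module.finrank ℝ E) α β 1 y = y⁻¹ * min (y ^ α) (y ^ (-β)) := by
    intro y hy
    obtain ⟨m, hm⟩ : ∃ m, Module.finrank ℝ E = m + 1 := ⟨_, (Nat.succ_pred_eq_of_pos hk).symm⟩
    rw [hm, scaleProfile, smul_eq_mul, ← mul_assoc, div_one]
    congr 1
    simp only [Nat.add_sub_cancel, pow_succ]
    field_simp
  rw [← Set.Ioc_union_Ioi_eq_Ioi zero_le_one]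
  refine IntegrableOn.union ?_ ?_
  · have h1 : IntegrableOn (fun y : ℝ => y ^ (α - 1)) (Set.Ioc 0 1) :=
      (intervalIntegrable_iff_integrableOn_Ioc_of_le zero_le_one).1
        (intervalIntegral.intervalIntegrable_rpow' (by linarith))
    refine Integrable.mono' h1 hm.aestronglyMeasurable ?_
    filter_upwards [ae_restrict_mem measurableSet_Ioc] with y hy
    have hy0 := hy.1
    rw [key y hy0, Real.norm_of_nonneg (by positivity), Real.rpow_sub_one hy0.ne', div_eq_inv_mul]
    gcongr
    exact min_le_left _ _
  · have h1 : IntegrableOn (fun y : ℝ => y ^ (-β - 1)) (Set.Ioi 1) :=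
      integrableOn_Ioi_rpow_of_lt (by linarith) zero_lt_one
    refine Integrable.mono' h1 hm.aestronglyMeasurable ?_
    filter_upwards [ae_restrict_mem measurableSet_Ioi] with y hy
    have hy0 : 0 < y := zero_lt_one.trans hy
    rw [key y hy0, Real.norm_of_nonneg (by positivity), Real.rpow_sub_one hy0.ne', div_eq_inv_mul]
    gcongr
    exact min_le_right _ _

lemma exists_lintegral_scaleProfile_le {E : Type*} [NormedAddCommGroup E] [NormedSpace ℝ E]
    [FiniteDimensional ℝ E] [Nontrivial E] [MeasurableSpace E] [BorelSpace E] (μ : Measure E)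
    [μ.IsAddHaarMeasure] {α β : ℝ} (hα : 0 < α) (hβ : 0 < β) :
    ∃ C : ℝ, 0 < C ∧ ∀ l : ℝ, 0 < l →
      ∫⁻ z : E, ENNReal.ofReal (scaleProfile (Module.finrank ℝ E) α β l ‖z‖) ∂μ
        ≤ ENNReal.ofReal C := by
  have hI := integrable_scaleProfile_one μ hα hβ
  -- Adding `1` makes the constant positive without a separate argument; the substitution `z = l w`
  -- then removes the scale.
  refine ⟨(∫ z : E, scaleProfile (Module.finrank ℝ E) α β 1 ‖z‖ ∂μ) + 1, ?_, fun l hl => ?_⟩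
  · have : 0 ≤ ∫ z : E, scaleProfile (Module.finrank ℝ E) α β 1 ‖z‖ ∂μ :=
      integral_nonneg fun z => scaleProfile_nonneg _ _ _ zero_le_one (norm_nonneg _)
    linarith
  have hs : ∀ z : E, scaleProfile (Module.finrank ℝ E) α β l ‖z‖ =
      (l ^ Module.finrank ℝ E)⁻¹ * scaleProfile (Module.finrank ℝ E) α β 1 ‖l⁻¹ • z‖ := by
    intro z
    rw [norm_smul, Real.norm_of_nonneg (by positivity), scaleProfile, scaleProfile, div_one,
      ← mul_assoc, ← mul_inv, ← mul_pow, mul_inv_cancel_left₀ hl.ne', div_eq_inv_mul]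
  simp_rw [hs]
  rw [← ofReal_integral_eq_lintegral_ofReal ((hI.comp_smul (inv_ne_zero hl.ne')).const_mul _)
    (Filter.Eventually.of_forall fun z => mul_nonneg (by positivity)
      (scaleProfile_nonneg _ _ _ zero_le_one (norm_nonneg _)))]
  refine ENNReal.ofReal_le_ofReal ?_
  rw [integral_const_mul, Measure.integral_comp_inv_smul μ
    (fun z : E => scaleProfile (Module.finrank ℝ E) α β 1 ‖z‖), smul_eq_mul, abs_of_pos (by positivity),
    inv_mul_cancel_left₀ (by positivity)]
  linarith

/-- For `a ≤ τ` the left side is `τ^{-θ} a^{-d} (a/τ)^d`, for `a ≥ τ` it is `τ^{-θ} a^{-d}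
(a/τ)^{-θ}`; in each range the other power of `a/τ` is the larger one. -/
lemma max_rpow_le_scaleProfile {d : ℕ} {θ a τ : ℝ} (hθ : 0 < θ) (ha : 0 < a) (hτ : 0 < τ) :
    max a τ ^ (-((d : ℝ) + θ)) ≤ τ ^ (-θ) * scaleProfile d d θ τ a := by
  have h1 : 0 < a / τ := by positivity
  rcases le_total a τ with h | h
  · have h2 : a / τ ≤ 1 := (div_le_one hτ).2 h
    have h3 : (a / τ) ^ (d : ℝ) ≤ (a / τ) ^ (-θ) :=
      (Real.rpow_le_one h1.le h2 (Nat.cast_nonneg d)).trans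
        (Real.one_le_rpow_of_pos_of_le_one_of_nonpos h1 h2 (by linarith))
    rw [max_eq_right h, scaleProfile, min_eq_left h3, Real.rpow_natCast, div_pow, neg_add,
      Real.rpow_add hτ, Real.rpow_neg hτ.le (d : ℝ), Real.rpow_natCast]
    apply le_of_eq
    field_simp
  · have h2 : 1 ≤ a / τ := (one_le_div hτ).2 h
    have h3 : (a / τ) ^ (-θ) ≤ (a / τ) ^ (d : ℝ) :=
      (Real.rpow_le_one_of_one_le_of_nonpos h2 (by linarith)).trans
        (Real.one_le_rpow h2 (Nat.cast_nonneg d))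
    rw [max_eq_left h, scaleProfile, min_eq_right h3, Real.div_rpow ha.le hτ.le, neg_add,
      Real.rpow_add ha, Real.rpow_neg ha.le (d : ℝ), Real.rpow_natCast]
    apply le_of_eq
    have : τ ^ (-θ) ≠ 0 := by positivity
    field_simp

lemma exists_lintegral_max_rpow_le {d : ℕ} (hd : 0 < d) {θ : ℝ} (hθ : 0 < θ) :
    ∃ C : ℝ, 0 < C ∧ ∀ τ : ℝ, 0 < τ → ∀ y : R d,
      ∫⁻ x : R d, ENNReal.ofReal (max ‖x - y‖ τ ^ (-((d : ℝ) + θ)))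
        ≤ ENNReal.ofReal (C * τ ^ (-θ)) := by
  have : Nonempty (Fin d) := ⟨⟨0, hd⟩⟩
  have hd' : (0 : ℝ) < d := Nat.cast_pos.2 hd
  obtain ⟨C, hC, h⟩ := exists_lintegral_scaleProfile_le (volume : Measure (R d)) hd' hθ
  rw [finrank_euclideanSpace_fin] at h
  refine ⟨C, hC, fun τ hτ y => ?_⟩
  rw [lintegral_sub_right_eq_self (fun x : R d => ENNReal.ofReal (max ‖x‖ τ ^ (-((d : ℝ) + θ))))]
  calc _ ≤ ∫⁻ x : R d, ENNReal.ofReal (τ ^ (-θ)) * ENNReal.ofReal (scaleProfile d d θ τ ‖x‖) := by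
        refine lintegral_mono_ae ?_
        filter_upwards [Measure.ae_ne volume (0 : R d)] with x hx
        rw [← ENNReal.ofReal_mul (by positivity)]
        exact ENNReal.ofReal_le_ofReal (max_rpow_le_scaleProfile hθ (norm_pos_iff.2 hx) hτ)
    _ ≤ _ := by
        rw [lintegral_const_mul' _ _ ENNReal.ofReal_ne_top, mul_comm C,
          ENNReal.ofReal_mul (by positivity)]
        exact mul_le_mul_right (h τ hτ) _

/-- The function `r^{-d-γ} min(1, r/A)^m`. -/
def truncPow (d : ℕ) (γ : ℝ) (m : ℕ) (A r : ℝ) : ℝ := r ^ (-((d : ℝ) + γ)) * min 1 (r / A) ^ m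

lemma truncPow_nonneg {d : ℕ} {γ : ℝ} {m : ℕ} {A r : ℝ} (hA : 0 ≤ A) (hr : 0 ≤ r) :
    0 ≤ truncPow d γ m A r := by
  unfold truncPow; positivity

lemma truncPow_eq_min {d : ℕ} {γ : ℝ} {m : ℕ} {A r : ℝ} (hA : 0 < A) (hr : 0 < r) :
    truncPow d γ m A r =
      min (r ^ (-((d : ℝ) + γ))) ((A ^ m)⁻¹ * r ^ ((m : ℝ) - ((d : ℝ) + γ))) := by
  have h : min 1 (r / A) ^ m = min 1 ((r / A) ^ m) := by
    rcases le_total 1 (r / A) with h | h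
    · rw [min_eq_left h, min_eq_left (one_le_pow₀ h), one_pow]
    · rw [min_eq_right h, min_eq_right (pow_le_one₀ (by positivity) h)]
  rw [truncPow, h, mul_min_of_nonneg _ _ (by positivity), mul_one, sub_eq_neg_add,
    Real.rpow_add hr, Real.rpow_natCast, div_pow]
  congr 1
  field_simp

/-- The condition `m ≤ d + γ` makes both branches of the minimum nonincreasing in `r`. Monotonicity
permits replacing a distance in `ℝⁿ` by the smaller horizontal one. -/
lemma truncPow_antitone {d : ℕ} {γ : ℝ} {m : ℕ} {A r s : ℝ} (hA : 0 < A) (hr : 0 < r)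
    (hrs : r ≤ s) (hm : (m : ℝ) ≤ d + γ) : truncPow d γ m A s ≤ truncPow d γ m A r := by
  rw [truncPow_eq_min hA hr, truncPow_eq_min hA (hr.trans_le hrs)]
  have : (0 : ℝ) ≤ m := Nat.cast_nonneg m
  exact min_le_min (Real.rpow_le_rpow_of_nonpos hr hrs (by linarith))
    (mul_le_mul_of_nonneg_left (Real.rpow_le_rpow_of_nonpos hr hrs (by linarith)) (by positivity))

lemma truncPow_le_scaleProfile {d : ℕ} {γ : ℝ} {m : ℕ} {A r : ℝ} (hA : 0 < A) (hr : 0 < r) :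
    truncPow d γ m A r ≤ A ^ (-γ) * scaleProfile d (m - γ) γ A r := by
  apply le_of_eq
  rw [truncPow_eq_min hA hr, scaleProfile, ← mul_assoc, mul_min_of_nonneg _ _ (by positivity), min_comm]
  congr 1
  · rw [Real.div_rpow hr.le hA.le, Real.rpow_sub hA, Real.rpow_sub hr, Real.rpow_sub hr,
      Real.rpow_add hr, Real.rpow_neg hA.le, Real.rpow_natCast, Real.rpow_natCast, Real.rpow_natCast]
    field_simp
  · rw [Real.div_rpow hr.le hA.le, neg_add, Real.rpow_add hr, Real.rpow_neg hr.le (d : ℝ),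
      Real.rpow_natCast]
    have : A ^ (-γ) ≠ 0 := by positivity
    field_simp

/-- The truncation lowers the singularity at `0` to `r^{m-d-γ}`, integrable because `γ < m`; the
decay `r^{-d-γ}` at infinity is integrable because `γ > 0`. -/
lemma exists_lintegral_truncPow_le {d : ℕ} (hd : 0 < d) {γ : ℝ} {m : ℕ} (hγ : 0 < γ) (hm : γ < m) :
    ∃ C : ℝ, 0 < C ∧ ∀ A : ℝ, 0 < A → ∀ y : R d,
      ∫⁻ z : R d, ENNReal.ofReal (truncPow d γ m A ‖z - y‖) ≤ ENNReal.ofReal (C * A ^ (-γ)) := by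
  have : Nonempty (Fin d) := ⟨⟨0, hd⟩⟩
  obtain ⟨C, hC, h⟩ := exists_lintegral_scaleProfile_le (volume : Measure (R d)) (sub_pos.2 hm) hγ
  rw [finrank_euclideanSpace_fin] at h
  refine ⟨C, hC, fun A hA y => ?_⟩
  rw [lintegral_sub_right_eq_self (fun x : R d => ENNReal.ofReal (truncPow d γ m A ‖x‖))]
  calc _ ≤ ∫⁻ x : R d, ENNReal.ofReal (A ^ (-γ)) *
          ENNReal.ofReal (scaleProfile d (m - γ) γ A ‖x‖) := by
        refine lintegral_mono_ae ?_
        filter_upwards [Measure.ae_ne volume (0 : R d)] with x hx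
        rw [← ENNReal.ofReal_mul (by positivity)]
        exact ENNReal.ofReal_le_ofReal (truncPow_le_scaleProfile hA (norm_pos_iff.2 hx))
    _ ≤ _ := by
        rw [lintegral_const_mul' _ _ ENNReal.ofReal_ne_top, mul_comm C,
          ENNReal.ofReal_mul (by positivity)]
        exact mul_le_mul_right (h A hA) _

/-! ### The majorant of the kernel -/

/-- `A^{-d} min(1, r/A)`. -/
def truncKernel (d : ℕ) (r A : ℝ) : ℝ := (A ^ d)⁻¹ * min 1 (r / A)

lemma truncKernel_nonneg {d : ℕ} {r A : ℝ} (hr : 0 ≤ r) (hA : 0 ≤ A) : 0 ≤ truncKernel d r A := by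
  unfold truncKernel; positivity

lemma truncKernel_antitone {d : ℕ} {r A B : ℝ} (hr : 0 ≤ r) (hA : 0 < A) (hAB : A ≤ B) :
    truncKernel d r B ≤ truncKernel d r A := by
  unfold truncKernel
  have hB := hA.trans_le hAB
  gcongr

/-- Interpolation: `min(1, s) ≤ s^θ` for `0 < θ ≤ 1`. -/
lemma truncKernel_le_rpow {d : ℕ} {θ r A : ℝ} (hθ : 0 < θ) (hθ1 : θ ≤ 1) (hr : 0 ≤ r) (hA : 0 < A) :
    truncKernel d r A ≤ r ^ θ * A ^ (-((d : ℝ) + θ)) := by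
  have h1 : min 1 (r / A) ≤ (r / A) ^ θ := by
    rcases le_total 1 (r / A) with h | h
    · exact (min_le_left _ _).trans (Real.one_le_rpow h hθ.le)
    · refine (min_le_right _ _).trans ?_
      have := Real.rpow_le_rpow_of_exponent_ge' (by positivity : 0 ≤ r / A) h hθ.le hθ1
      rwa [Real.rpow_one] at this
  rw [neg_add, Real.rpow_add hA, Real.rpow_neg hA.le (d : ℝ), Real.rpow_natCast, truncKernel]
  refine (mul_le_mul_of_nonneg_left h1 (by positivity)).trans (le_of_eq ?_)
  rw [Real.div_rpow hr hA.le, Real.rpow_neg hA.le]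
  field_simp

/-- Two values of `θ` are kept for the later integration against `τ^{-1/2} dτ`: `θ = 1` gives decay
as `τ → ∞`, while `θ = 1/4`, being below `1/2`, gives integrability at `τ = 0`. -/
lemma exists_lintegral_truncKernel_max_le {d : ℕ} (hd : 0 < d) :
    ∃ C : ℝ, 0 < C ∧ ∀ r τ : ℝ, 0 < r → 0 < τ → ∀ y : R d,
      ∫⁻ x : R d, ENNReal.ofReal (truncKernel d r (max ‖x - y‖ τ))
        ≤ ENNReal.ofReal (C * min ((r / τ) ^ (1 / 4 : ℝ)) (r / τ)) := by
  have main : ∀ θ : ℝ, 0 < θ → θ ≤ 1 → ∃ C : ℝ, 0 < C ∧ ∀ r τ : ℝ, 0 < r → 0 < τ → ∀ y : R d,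
      ∫⁻ x : R d, ENNReal.ofReal (truncKernel d r (max ‖x - y‖ τ))
        ≤ ENNReal.ofReal (C * (r / τ) ^ θ) := by
    intro θ hθ hθ1
    obtain ⟨C, hC, h⟩ := exists_lintegral_max_rpow_le hd hθ
    refine ⟨C, hC, fun r τ hr hτ y => ?_⟩
    calc _ ≤ ∫⁻ x : R d, ENNReal.ofReal (r ^ θ) *
          ENNReal.ofReal (max ‖x - y‖ τ ^ (-((d : ℝ) + θ))) := by
          refine lintegral_mono fun x => ?_
          rw [← ENNReal.ofReal_mul (by positivity)]
          exact ENNReal.ofReal_le_ofReal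
            (truncKernel_le_rpow hθ hθ1 hr.le (lt_max_of_lt_right hτ))
      _ ≤ _ := by
          rw [lintegral_const_mul' _ _ ENNReal.ofReal_ne_top]
          refine (mul_le_mul_right (h τ hτ y) _).trans (le_of_eq ?_)
          rw [← ENNReal.ofReal_mul (by positivity), Real.div_rpow hr.le hτ.le,
            Real.rpow_neg hτ.le]
          congr 1; field_simp
  obtain ⟨C₁, hC₁, h₁⟩ := main (1 / 4) (by norm_num) (by norm_num)
  obtain ⟨C₂, hC₂, h₂⟩ := main 1 (by norm_num) (by norm_num)
  refine ⟨max C₁ C₂, by positivity, fun r τ hr hτ y => ?_⟩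
  rw [mul_min_of_nonneg _ _ (by positivity), ENNReal.ofReal_min]
  refine le_min ((h₁ r τ hr hτ y).trans (ENNReal.ofReal_le_ofReal ?_))
    ((h₂ r τ hr hτ y).trans (ENNReal.ofReal_le_ofReal ?_))
  · gcongr; exact le_max_left _ _
  · rw [Real.rpow_one]; gcongr; exact le_max_right _ _

lemma exists_lintegral_rpow_min_le :
    ∃ C : ℝ, 0 < C ∧ ∀ r : ℝ, 0 < r →
      ∫⁻ s : ℝ, ENNReal.ofReal (|s| ^ (-(1 / 2) : ℝ) * min ((r / |s|) ^ (1 / 4 : ℝ)) (r / |s|))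
        ≤ ENNReal.ofReal (C * r ^ (1 / 2 : ℝ)) := by
  obtain ⟨C, hC, h⟩ := exists_lintegral_scaleProfile_le (volume : Measure ℝ)
    (by norm_num : (0 : ℝ) < 1 / 4) (by norm_num : (0 : ℝ) < 1 / 2)
  rw [Module.finrank_self] at h
  refine ⟨C, hC, fun r hr => ?_⟩
  calc _ ≤ ∫⁻ s : ℝ, ENNReal.ofReal (r ^ (1 / 2 : ℝ)) *
          ENNReal.ofReal (scaleProfile 1 (1 / 4) (1 / 2) r ‖s‖) := by
        refine lintegral_mono_ae ?_
        filter_upwards [Measure.ae_ne volume (0 : ℝ)] with s hs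
        rw [← ENNReal.ofReal_mul (by positivity), Real.norm_eq_abs]
        refine ENNReal.ofReal_le_ofReal (le_of_eq ?_)
        have ha : 0 < |s| := abs_pos.2 hs
        generalize |s| = a at ha
        rw [scaleProfile, pow_one, ← mul_assoc, mul_min_of_nonneg _ _ (by positivity),
          mul_min_of_nonneg _ _ (by positivity)]
        -- In terms of the fourth roots of `a` and `r` all exponents become integers, and the claim
        -- is an identity of rational functions.
        have half : ∀ b : ℝ, 0 < b → b ^ (1 / 2 : ℝ) = (b ^ (1 / 4 : ℝ)) ^ 2 := fun b hb => by
          rw [← Real.rpow_natCast, ← Real.rpow_mul hb.le]; norm_num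
        have full : ∀ b : ℝ, 0 < b → b = (b ^ (1 / 4 : ℝ)) ^ 4 := fun b hb => by
          rw [← Real.rpow_natCast, ← Real.rpow_mul hb.le]; norm_num
        rw [Real.div_rpow hr.le ha.le, Real.div_rpow ha.le hr.le, Real.rpow_neg ha.le,
          Real.rpow_neg (by positivity : 0 ≤ a / r), Real.div_rpow ha.le hr.le, half a ha, half r hr]
        have hu : 0 < a ^ (1 / 4 : ℝ) := by positivity
        have hw : 0 < r ^ (1 / 4 : ℝ) := by positivity
        have ea := full a ha
        have er := full r hr
        generalize a ^ (1 / 4 : ℝ) = u at *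
        generalize r ^ (1 / 4 : ℝ) = w at *
        subst ea er
        congr 1 <;> field_simp
    _ ≤ _ := by
        rw [lintegral_const_mul' _ _ ENNReal.ofReal_ne_top, mul_comm C,
          ENNReal.ofReal_mul (by positivity)]
        exact mul_le_mul_right (h r hr) _

/-! ### The gradient of the fundamental solution -/

/-- Up to a constant, `E` is `(|x|²)^{(2-n)/2}`, a real power of a smooth function that is positive
away from `0`. -/
lemma hasGradientAt_fundSol {n : ℕ} (hn : 3 ≤ n) {x : R n} (hx : x ≠ 0) :
    HasGradientAt (fundSol n)
      ((-(n * volume.real (Metric.ball (0 : R n) 1))⁻¹) • ((‖x‖ ^ n)⁻¹ • x)) x := by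
  have hpos : 0 < ‖x‖ := norm_pos_iff.2 hx
  have h1 : HasFDerivAt (fun x : R n => ‖x‖ ^ 2) (2 • innerSL ℝ x) x :=
    (hasStrictFDerivAt_norm_sq x).hasFDerivAt
  have h2 := h1.rpow_const (p := (2 - (n : ℝ)) / 2) (Or.inl (by positivity))
  have h3 := h2.mul_const (n * (n - 2) * volume.real (Metric.ball (0 : R n) 1) : ℝ)⁻¹
  have h4 : (fun x : R n => (‖x‖ ^ 2) ^ ((2 - (n : ℝ)) / 2) *
      (n * (n - 2) * volume.real (Metric.ball (0 : R n) 1) : ℝ)⁻¹) = fundSol n := by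
    ext z
    rw [fundSol, div_eq_mul_inv, ← Real.rpow_natCast, ← Real.rpow_mul (norm_nonneg z),
      ← Real.rpow_intCast]
    congr 2
    push_cast; ring
  rw [h4] at h3
  have h5 : (‖x‖ ^ 2) ^ ((2 - (n : ℝ)) / 2 - 1) = (‖x‖ ^ n)⁻¹ := by
    rw [← Real.rpow_natCast, ← Real.rpow_mul hpos.le, ← Real.rpow_natCast, ← Real.rpow_neg hpos.le]
    congr 1; push_cast; ring
  refine hasGradientAt_iff_hasFDerivAt.2 (h3.congr_fderiv ?_)
  ext v
  have hn2 : (n : ℝ) - 2 ≠ 0 := by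
    have : (3 : ℝ) ≤ n := by exact_mod_cast hn
    linarith
  simp only [h5, InnerProductSpace.toDual_apply_apply, real_inner_smul_left, mul_inv,
    smul_apply, innerSL_apply_apply, smul_eq_mul, nsmul_eq_mul]
  push_cast
  field_simp
  ring

lemma gradient_fundSol {n : ℕ} (hn : 3 ≤ n) {x : R n} (hx : x ≠ 0) :
    gradient (fundSol n) x =
      (-(n * volume.real (Metric.ball (0 : R n) 1))⁻¹) • ((‖x‖ ^ n)⁻¹ • x) :=
  (hasGradientAt_fundSol hn hx).gradient

/-- The size bound `|u|^{-d} + |v|^{-d}` and a Lipschitz bound are combined; by symmetry `|u| ≤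
|v|`. A mean value argument along the segment is avoided, since the segment may pass near the
singularity. -/
lemma norm_inv_pow_smul_sub_le {E : Type*} [NormedAddCommGroup E] [NormedSpace ℝ E] (d : ℕ)
    {u v : E} (hu : u ≠ 0) (hv : v ≠ 0) :
    ‖(‖u‖ ^ (d + 1))⁻¹ • u - (‖v‖ ^ (d + 1))⁻¹ • v‖ ≤
      (d + 2) * (truncKernel d ‖u - v‖ ‖u‖ + truncKernel d ‖u - v‖ ‖v‖) := by
  have main : ∀ {u v : E}, u ≠ 0 → v ≠ 0 → ‖u‖ ≤ ‖v‖ →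
      ‖(‖u‖ ^ (d + 1))⁻¹ • u - (‖v‖ ^ (d + 1))⁻¹ • v‖ ≤ (d + 2) * truncKernel d ‖u - v‖ ‖u‖ := by
    intro u v hu hv huv
    have hA : 0 < ‖u‖ := norm_pos_iff.2 hu
    have hB : 0 < ‖v‖ := norm_pos_iff.2 hv
    have hd : (0 : ℝ) ≤ d := Nat.cast_nonneg d
    have hnorm : ∀ w : E, w ≠ 0 → ‖(‖w‖ ^ (d + 1))⁻¹ • w‖ = (‖w‖ ^ d)⁻¹ := by
      intro w hw
      have : ‖w‖ ≠ 0 := norm_ne_zero_iff.2 hw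
      rw [norm_smul, norm_inv, norm_pow, norm_norm, pow_succ]
      field_simp
    rw [truncKernel, mul_min_of_nonneg _ _ (by positivity), mul_min_of_nonneg _ _ (by positivity)]
    refine le_min ?_ ?_
    · refine (norm_sub_le _ _).trans ?_
      rw [hnorm u hu, hnorm v hv]
      have : (‖v‖ ^ d)⁻¹ ≤ (‖u‖ ^ d)⁻¹ := by gcongr
      have h0 : 0 ≤ (‖u‖ ^ d)⁻¹ := by positivity
      nlinarith
    -- The difference splits into a change of direction, costing `|u - v| / |u|^{d+1}`, and a change
    -- of the radial factor, costing `d + 1` times as much; this explains the constant `d + 2`.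
    · have e : (‖u‖ ^ (d + 1))⁻¹ • u - (‖v‖ ^ (d + 1))⁻¹ • v =
          (‖u‖ ^ (d + 1))⁻¹ • (u - v) + ((‖u‖ ^ (d + 1))⁻¹ - (‖v‖ ^ (d + 1))⁻¹) • v := by
        rw [smul_sub, sub_smul]; abel
      have h1 : ‖v‖ ^ (d + 1) - ‖u‖ ^ (d + 1) ≤ ‖u - v‖ * (d + 1) * ‖v‖ ^ d := by
        have h2 := abs_pow_sub_pow_le ‖v‖ ‖u‖ (d + 1)
        rw [abs_norm, abs_norm, max_eq_left huv, Nat.add_sub_cancel] at h2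
        push_cast at h2
        refine (le_abs_self _).trans (h2.trans ?_)
        have h3 := abs_norm_sub_norm_le u v
        rw [abs_sub_comm] at h3
        gcongr
      have h2 : ((‖u‖ ^ (d + 1))⁻¹ - (‖v‖ ^ (d + 1))⁻¹) * ‖v‖ ≤
          (d + 1) * ‖u - v‖ * (‖u‖ ^ (d + 1))⁻¹ := by
        have h3 : ((‖u‖ ^ (d + 1))⁻¹ - (‖v‖ ^ (d + 1))⁻¹) * ‖v‖ =
            (‖v‖ ^ (d + 1) - ‖u‖ ^ (d + 1)) * ((‖u‖ ^ (d + 1))⁻¹ * (‖v‖ ^ d)⁻¹) := by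
          field_simp
          ring
        rw [h3]
        refine (mul_le_mul_of_nonneg_right h1 (by positivity)).trans (le_of_eq ?_)
        field_simp
      have h4 : 0 ≤ (‖u‖ ^ (d + 1))⁻¹ - (‖v‖ ^ (d + 1))⁻¹ := by
        rw [sub_nonneg]; gcongr
      rw [e]
      refine (norm_add_le _ _).trans ?_
      rw [norm_smul, norm_smul, Real.norm_of_nonneg h4, Real.norm_of_nonneg (by positivity)]
      refine (add_le_add_right h2 _).trans (le_of_eq ?_)
      field_simp
      ring
  rcases le_total ‖u‖ ‖v‖ with h | h
  · refine (main hu hv h).trans ?_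
    gcongr
    exact le_add_of_nonneg_right (truncKernel_nonneg (norm_nonneg _) (norm_nonneg _))
  · rw [norm_sub_rev, norm_sub_rev u v]
    refine (main hv hu h).trans ?_
    gcongr
    exact le_add_of_nonneg_left (truncKernel_nonneg (norm_nonneg _) (norm_nonneg _))

lemma measurable_gradKernel {n : ℕ} (j : Fin n) {Ω : Type*} [MeasurableSpace Ω] {f g : Ω → R n}
    (hf : Measurable f) (hg : Measurable g) : Measurable fun a => gradKernel (f a) j (g a) := by
  have h1 : Measurable (gradient (fundSol n)) :=
    (InnerProductSpace.toDual ℝ (R n)).symm.continuous.measurable.comp (measurable_fderiv ℝ _)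
  have h2 : Measurable fun x : R n => gradient (fundSol n) x j :=
    (EuclideanSpace.proj (𝕜 := ℝ) j).continuous.measurable.comp h1
  unfold gradKernel
  exact Complex.measurable_ofReal.comp (h2.comp (hf.sub hg))

lemma norm_coord_le {n : ℕ} (x : R n) (j : Fin n) : ‖x j‖ ≤ ‖x‖ := PiLp.norm_apply_le x j

lemma exists_gradKernel_le (d : ℕ) (hd : 2 ≤ d) :
    ∃ C : ℝ, 0 < C ∧
      (∀ x y : R (d + 1), ∀ j, x ≠ y → ‖gradKernel x j y‖ ≤ C * (‖x - y‖ ^ d)⁻¹) ∧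
      ∀ x y z : R (d + 1), ∀ j, x ≠ y → x ≠ z → ‖gradKernel x j y - gradKernel x j z‖ ≤
        C * (truncKernel d ‖y - z‖ ‖x - y‖ + truncKernel d ‖y - z‖ ‖x - z‖) := by
  set c : ℝ := ((d + 1 : ℕ) * volume.real (Metric.ball (0 : R (d + 1)) 1))⁻¹ with hc
  have hc0 : 0 < c := by
    have : 0 < volume.real (Metric.ball (0 : R (d + 1)) 1) := by
      refine ENNReal.toReal_pos (Metric.measure_ball_pos _ _ one_pos).ne' measure_ball_lt_top.ne
    positivity
  refine ⟨c * (d + 2), by positivity, fun x y j hxy => ?_, fun x y z j hxy hxz => ?_⟩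
  · have h : x - y ≠ 0 := sub_ne_zero.2 hxy
    rw [gradKernel, Complex.norm_real, gradient_fundSol (by omega) h]
    refine (norm_coord_le _ j).trans ?_
    have h0 : 0 < ‖x - y‖ := norm_pos_iff.2 h
    rw [norm_smul, norm_neg, Real.norm_of_nonneg hc0.le, norm_smul, norm_inv, norm_pow, norm_norm,
      pow_succ, mul_inv, inv_mul_cancel_right₀ h0.ne', mul_assoc]
    have : (0 : ℝ) ≤ d := Nat.cast_nonneg d
    have h1 : 0 < (‖x - y‖ ^ d)⁻¹ := by positivity
    gcongr
    nlinarith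
  · have h : x - y ≠ 0 := sub_ne_zero.2 hxy
    have h' : x - z ≠ 0 := sub_ne_zero.2 hxz
    rw [gradKernel, gradKernel, ← Complex.ofReal_sub, Complex.norm_real,
      gradient_fundSol (by omega) h, gradient_fundSol (by omega) h', ← PiLp.sub_apply, ← smul_sub]
    refine (norm_coord_le _ j).trans ?_
    rw [norm_smul, norm_neg, Real.norm_of_nonneg hc0.le, mul_assoc]
    have := norm_inv_pow_smul_sub_le d h h'
    rw [sub_sub_sub_cancel_left, norm_sub_rev z y] at this
    gcongr

/-! ### The Schur test -/

lemma ENNReal.lintegral_mul_sq_le {W : Type*} [MeasurableSpace W] (ν : Measure W)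
    {f g : W → ℝ≥0∞} (hf : AEMeasurable f ν) (hg : AEMeasurable g ν) :
    (∫⁻ w, f w ^ (1 / 2 : ℝ) * g w ^ (1 / 2 : ℝ) ∂ν) ^ 2 ≤ (∫⁻ w, f w ∂ν) * ∫⁻ w, g w ∂ν := by
  have h := ENNReal.lintegral_mul_le_Lp_mul_Lq ν Real.HolderConjugate.two_two
    (hf.pow_const (1 / 2 : ℝ)) (hg.pow_const (1 / 2 : ℝ))
  have e : ∀ a : ℝ≥0∞, (a ^ (1 / 2 : ℝ)) ^ (2 : ℝ) = a := fun a => by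
    rw [← ENNReal.rpow_mul]; norm_num
  have e' : ∀ a : ℝ≥0∞, (a ^ (1 / 2 : ℝ)) ^ 2 = a := fun a => by
    rw [← ENNReal.rpow_natCast]; exact e a
  simp only [Pi.mul_apply, e] at h
  calc _ ≤ _ := pow_le_pow_left' h 2
    _ = _ := by rw [mul_pow, e', e']

/-- The Schur test for a nonnegative kernel. -/
lemma schur_test {X W : Type*} [MeasurableSpace X] [MeasurableSpace W] {μ : Measure X}
    {ν : Measure W} [SFinite μ] [SFinite ν] {k : X → W → ℝ≥0∞} {p : X → ℝ≥0∞} {q G : W → ℝ≥0∞}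
    {A B : ℝ≥0∞} (hk : Measurable (Function.uncurry k)) (hp : Measurable p) (hq : Measurable q)
    (hG : Measurable G) (hqt : ∀ w, q w ≠ ∞) (hkq : ∀ x w, q w = 0 → k x w = 0)
    (hA : ∀ᵐ x ∂μ, ∫⁻ w, k x w * q w ∂ν ≤ A * p x)
    (hB : ∀ᵐ w ∂ν, ∫⁻ x, k x w * p x ∂μ ≤ B * q w) :
    ∫⁻ x, (∫⁻ w, k x w * G w ∂ν) ^ 2 ∂μ ≤ A * B * ∫⁻ w, G w ^ 2 ∂ν := by
  have hkx : ∀ x, Measurable (k x) := fun x => hk.comp measurable_prodMk_left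
  have hkw : ∀ w, Measurable fun x => k x w := fun w => hk.comp measurable_prodMk_right
  -- Cauchy–Schwarz for `k G = (k q)^{1/2} (k G² / q)^{1/2}`. Where `q = 0` the factorization fails,
  -- but there `k` vanishes as well.
  have h1 : ∀ x, (∫⁻ w, k x w * G w ∂ν) ^ 2 ≤
      (∫⁻ w, k x w * q w ∂ν) * ∫⁻ w, k x w * (G w ^ 2 * (q w)⁻¹) ∂ν := by
    intro x
    refine le_trans (pow_le_pow_left' (lintegral_mono fun w => ?_) 2)
      (ENNReal.lintegral_mul_sq_le ν ((hkx x).mul hq).aemeasurable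
        ((hkx x).mul ((hG.pow_const 2).mul hq.inv)).aemeasurable)
    rcases eq_or_ne (q w) 0 with h0 | h0
    · simp [hkq x w h0]
    · rw [← ENNReal.mul_rpow_of_nonneg _ _ (by norm_num : (0 : ℝ) ≤ 1 / 2)]
      have : k x w * q w * (k x w * (G w ^ 2 * (q w)⁻¹)) = (k x w * G w) ^ 2 := by
        rw [show k x w * q w * (k x w * (G w ^ 2 * (q w)⁻¹)) =
          (q w * (q w)⁻¹) * (k x w * G w) ^ 2 by ring, ENNReal.mul_inv_cancel h0 (hqt w), one_mul]
      rw [this, ← ENNReal.rpow_natCast, ← ENNReal.rpow_mul]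
      norm_num
  calc _ ≤ ∫⁻ x, A * ∫⁻ w, p x * (k x w * (G w ^ 2 * (q w)⁻¹)) ∂ν ∂μ := by
        refine lintegral_mono_ae ?_
        filter_upwards [hA] with x hx
        rw [lintegral_const_mul _ (by exact (hkx x).mul ((hG.pow_const 2).mul hq.inv)), ← mul_assoc]
        exact (h1 x).trans (mul_le_mul_left hx _)
    _ = A * ∫⁻ w, ∫⁻ x, p x * (k x w * (G w ^ 2 * (q w)⁻¹)) ∂μ ∂ν := by
        have hm : Measurable (Function.uncurry fun x w => p x * (k x w * (G w ^ 2 * (q w)⁻¹))) :=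
          (hp.comp measurable_fst).mul (hk.mul (((hG.comp measurable_snd).pow_const 2).mul
            (hq.comp measurable_snd).inv))
        rw [lintegral_const_mul _ hm.lintegral_prod_right, lintegral_lintegral_swap hm.aemeasurable]
    _ ≤ A * ∫⁻ w, B * G w ^ 2 ∂ν := by
        gcongr 1
        refine lintegral_mono_ae ?_
        filter_upwards [hB] with w hw
        have : ∀ x, p x * (k x w * (G w ^ 2 * (q w)⁻¹)) = k x w * p x * (G w ^ 2 * (q w)⁻¹) :=
          fun x => by ring
        simp_rw [this]
        rw [lintegral_mul_const _ (by exact (hkw w).mul hp)]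
        refine (mul_le_mul_left hw _).trans ?_
        rw [show B * q w * (G w ^ 2 * (q w)⁻¹) = (B * G w ^ 2) * (q w * (q w)⁻¹) by ring]
        exact mul_le_of_le_one_right' (ENNReal.mul_inv_le_one _)
    _ = _ := by rw [lintegral_const_mul _ (hG.pow_const 2), mul_assoc]

/-! ### Integrals over the graph -/

lemma measurable_truncPow (d : ℕ) (γ : ℝ) (m : ℕ) :
    Measurable fun p : ℝ × ℝ => truncPow d γ m p.1 p.2 := by
  unfold truncPow; fun_prop

/-- Parametrizing `Γ` by the graph costs the area factor `Cs h ^ d`. The horizontal projection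
shrinks distances and the integrand is decreasing, so the flat integral dominates. -/
lemma exists_lintegral_surface_truncPow_le {d : ℕ} (hd : 0 < d) {γ : ℝ} {m : ℕ} (hγ : 0 < γ)
    (hm : γ < m) (hmd : (m : ℝ) ≤ d + γ) :
    ∃ C : ℝ, 0 < C ∧ ∀ h : R d → ℝ, ContDiff ℝ 2 h → HasCompactSupport h →
      ∀ A : ℝ, 0 < A → ∀ y : R (d + 1),
      ∫⁻ z, ENNReal.ofReal (truncPow d γ m A ‖y - z‖) ∂surface h
        ≤ ENNReal.ofReal (C * Cs h ^ d * A ^ (-γ)) := by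
  obtain ⟨C, hC, H⟩ := exists_lintegral_truncPow_le hd hγ hm
  refine ⟨C, hC, fun h hh hc A hA y => ?_⟩
  have hL := one_le_Cs h
  have : Nonempty (Fin d) := ⟨⟨0, hd⟩⟩
  refine (lintegral_surface_le hh hc ((measurable_truncPow d γ m).comp
    (measurable_const.prodMk (by fun_prop))).ennreal_ofReal).trans ?_
  rw [mul_comm C, mul_assoc, ENNReal.ofReal_mul (by positivity)]
  refine mul_le_mul_right (le_trans (lintegral_mono_ae ?_) (H A hA (horizontal y))) _
  filter_upwards [Measure.ae_ne volume (horizontal y)] with z hz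
  refine ENNReal.ofReal_le_ofReal (truncPow_antitone hA (norm_pos_iff.2 (sub_ne_zero.2 hz)) ?_ hmd)
  rw [norm_sub_rev]
  exact norm_horizontal_sub_le y z (h z)

/-- On `Γ` one has `|x - y| ≥ max(|x' - y'|, τ)`, which reduces to the flat integral with a cut-off.
-/
lemma exists_lintegral_surface_rpow_le {d : ℕ} (hd : 0 < d) {θ : ℝ} (hθ : 0 < θ) :
    ∃ C : ℝ, 0 < C ∧ ∀ h : R d → ℝ, ContDiff ℝ 2 h → HasCompactSupport h →
      ∀ τ : ℝ, 0 < τ → ∀ x : R (d + 1), (∀ y ∈ boundary h, τ ≤ ‖x - y‖) →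
      ∫⁻ y, ENNReal.ofReal (‖x - y‖ ^ (-((d : ℝ) + θ))) ∂surface h
        ≤ ENNReal.ofReal (C * Cs h ^ d * τ ^ (-θ)) := by
  obtain ⟨C, hC, H⟩ := exists_lintegral_max_rpow_le hd hθ
  refine ⟨C, hC, fun h hh hc τ hτ x hx => ?_⟩
  have hL := one_le_Cs h
  have hd0 : (0 : ℝ) ≤ d := Nat.cast_nonneg d
  have hm : Measurable fun y : R (d + 1) => ENNReal.ofReal
      (max ‖horizontal x - horizontal y‖ τ ^ (-((d : ℝ) + θ))) := by
    have := continuous_horizontal (d := d).measurable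
    fun_prop
  calc _ ≤ ∫⁻ y, ENNReal.ofReal (max ‖horizontal x - horizontal y‖ τ ^ (-((d : ℝ) + θ)))
        ∂surface h := by
        refine lintegral_mono_ae ?_
        filter_upwards [ae_surface_mem_boundary h] with y hy
        refine ENNReal.ofReal_le_ofReal (Real.rpow_le_rpow_of_nonpos
          (lt_max_of_lt_right hτ) (max_le ?_ (hx y hy)) (by linarith))
        rw [← horizontal_sub]
        exact norm_horizontal_le _
    _ ≤ _ := by
        refine (lintegral_surface_le hh hc hm).trans ?_
        rw [mul_comm C, mul_assoc, ENNReal.ofReal_mul (by positivity)]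
        refine mul_le_mul_right (le_trans (le_of_eq ?_) (H τ hτ (horizontal x))) _
        simp only [horizontal_point, norm_sub_rev (horizontal x)]

/-- A majorant of the Gagliardo quotient of the gradient of the fundamental solution. -/
def schurKernel {d : ℕ} (x : R (d + 1)) (w : R (d + 1) × R (d + 1)) : ℝ :=
  ‖w.1 - w.2‖ ^ (-((d : ℝ) + 1) / 2) *
    (truncKernel d ‖w.1 - w.2‖ ‖x - w.1‖ + truncKernel d ‖w.1 - w.2‖ ‖x - w.2‖)

lemma measurable_schurKernel (d : ℕ) :
    Measurable (Function.uncurry (schurKernel : R (d + 1) → R (d + 1) × R (d + 1) → ℝ)) := by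
  unfold schurKernel truncKernel Function.uncurry
  fun_prop

lemma schurKernel_nonneg {d : ℕ} (x : R (d + 1)) (w : R (d + 1) × R (d + 1)) :
    0 ≤ schurKernel x w :=
  mul_nonneg (by positivity) (add_nonneg (truncKernel_nonneg (norm_nonneg _) (norm_nonneg _))
    (truncKernel_nonneg (norm_nonneg _) (norm_nonneg _)))

/-- The volume-preserving shear `s = xₙ - h(x')` flattens the weight, and `|x - y| ≥ max(|x' - y'|,
|s| / Cs h)` for `y ∈ Γ`. Integrating in `x'` and then in `s` gives `(r Cs h)^{1/2}`. -/
lemma exists_lintegral_truncKernel_mul_le {d : ℕ} (hd : 0 < d) :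
    ∃ C : ℝ, 0 < C ∧ ∀ h : R d → ℝ, ContDiff ℝ 2 h → HasCompactSupport h →
      ∀ r : ℝ, 0 < r → ∀ y ∈ boundary h,
      ∫⁻ x, ENNReal.ofReal (truncKernel d r ‖x - y‖ *
          |vertical x - h (horizontal x)| ^ (-(1 / 2) : ℝ))
        ≤ ENNReal.ofReal (C * Cs h * r ^ (1 / 2 : ℝ)) := by
  obtain ⟨C₁, hC₁, H₁⟩ := exists_lintegral_truncKernel_max_le hd
  obtain ⟨C₂, hC₂, H₂⟩ := exists_lintegral_rpow_min_le
  refine ⟨C₁ * C₂, by positivity, fun h hh hc r hr y hy => ?_⟩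
  have hL := one_le_Cs h
  have hL0 : 0 < Cs h := by linarith
  obtain ⟨y, rfl⟩ := boundary_subset_range hh.continuous hy
  have hm1 : Measurable fun x : R (d + 1) => ENNReal.ofReal (truncKernel d r ‖x - point y (h y)‖ *
      |vertical x - h (horizontal x)| ^ (-(1 / 2) : ℝ)) := by
    have h1 := continuous_horizontal (d := d).measurable
    have h2 := continuous_vertical (d := d).measurable
    have h3 := hh.continuous.measurable
    unfold truncKernel
    have h4 : Measurable fun x : R (d + 1) => |vertical x - h (horizontal x)| :=
      (continuous_abs.measurable).comp (h2.sub (h3.comp h1))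
    fun_prop
  have hm2 : Measurable fun p : R d × ℝ => ENNReal.ofReal
      (truncKernel d r (max ‖p.1 - y‖ (|p.2| / Cs h)) * |p.2| ^ (-(1 / 2) : ℝ)) := by
    unfold truncKernel
    have : Measurable fun p : R d × ℝ => |p.2| := continuous_abs.measurable.comp measurable_snd
    fun_prop
  rw [lintegral_eq_lintegral_point hm1]
  calc _ ≤ ∫⁻ x : R d, ∫⁻ s : ℝ, ENNReal.ofReal
          (truncKernel d r (max ‖x - y‖ (|s| / Cs h)) * |s| ^ (-(1 / 2) : ℝ)) := by
        refine lintegral_mono fun x => ?_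
        rw [← lintegral_add_right_eq_self _ (h x)]
        refine lintegral_mono_ae ?_
        filter_upwards [Measure.ae_ne volume (0 : ℝ)] with s hs
        rw [vertical_point, horizontal_point, add_sub_cancel_right]
        refine ENNReal.ofReal_le_ofReal (mul_le_mul_of_nonneg_right
          (truncKernel_antitone hr.le (lt_max_of_lt_right (by positivity)) (max_le ?_ ?_))
          (by positivity))
        · simpa using norm_horizontal_sub_le (point x (s + h x)) y (h y)
        · rw [div_le_iff₀' hL0]
          simpa using abs_vertical_sub_le hh hc (point x (s + h x)) y
    _ = ∫⁻ s : ℝ, ∫⁻ x : R d, ENNReal.ofReal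
          (truncKernel d r (max ‖x - y‖ (|s| / Cs h)) * |s| ^ (-(1 / 2) : ℝ)) :=
        lintegral_lintegral_swap hm2.aemeasurable
    _ ≤ ∫⁻ s : ℝ, ENNReal.ofReal C₁ * ENNReal.ofReal (|s| ^ (-(1 / 2) : ℝ) *
          min ((r * Cs h / |s|) ^ (1 / 4 : ℝ)) (r * Cs h / |s|)) := by
        refine lintegral_mono_ae ?_
        filter_upwards [Measure.ae_ne volume (0 : ℝ)] with s hs
        have hs0 : 0 < |s| := abs_pos.2 hs
        simp_rw [mul_comm _ (|s| ^ (-(1 / 2) : ℝ)),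
          ENNReal.ofReal_mul (by positivity : 0 ≤ |s| ^ (-(1 / 2) : ℝ))]
        rw [lintegral_const_mul' _ _ ENNReal.ofReal_ne_top, mul_left_comm,
          ← ENNReal.ofReal_mul hC₁.le]
        have := H₁ r (|s| / Cs h) hr (by positivity) y
        rw [div_div_eq_mul_div] at this
        exact mul_le_mul_right this _
    _ ≤ _ := by
        rw [lintegral_const_mul' _ _ ENNReal.ofReal_ne_top]
        refine (mul_le_mul_right (H₂ (r * Cs h) (by positivity)) _).trans ?_
        rw [← ENNReal.ofReal_mul hC₁.le, Real.mul_rpow hr.le hL0.le]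
        refine ENNReal.ofReal_le_ofReal ?_
        have : Cs h ^ (1 / 2 : ℝ) ≤ Cs h := by
          conv_rhs => rw [← Real.rpow_one (Cs h)]
          exact Real.rpow_le_rpow_of_exponent_le hL (by norm_num)
        calc C₁ * (C₂ * (r ^ (1 / 2 : ℝ) * Cs h ^ (1 / 2 : ℝ)))
            ≤ C₁ * (C₂ * (r ^ (1 / 2 : ℝ) * Cs h)) := by gcongr
          _ = _ := by ring

/-- The positive integral operator with kernel `schurKernel` is bounded from `L²(Γ × Γ)` to
`L²(ℝᵈ⁺¹)`. -/
lemma exists_lintegral_schurKernel_le {d : ℕ} (hd : 2 ≤ d) :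
    ∃ C : ℝ, 0 < C ∧ ∀ h : R d → ℝ, ContDiff ℝ 2 h → HasCompactSupport h →
      ∀ G : R (d + 1) × R (d + 1) → ℝ≥0∞, Measurable G →
      ∫⁻ x, (∫⁻ w, ENNReal.ofReal (schurKernel x w) * G w ∂((surface h).prod (surface h))) ^ 2
        ≤ ENNReal.ofReal (C * (Cs h ^ (d + 1)) ^ 2) *
          ∫⁻ w, G w ^ 2 ∂((surface h).prod (surface h)) := by
  have hd0 : 0 < d := by omega
  have hd2 : (2 : ℝ) ≤ d := by exact_mod_cast hd
  obtain ⟨C₁, hC₁, H₁⟩ := exists_lintegral_surface_truncPow_le hd0 (γ := 1 / 2) (m := 1)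
    (by norm_num) (by norm_num) (by push_cast; linarith)
  obtain ⟨C₂, hC₂, H₂⟩ := exists_lintegral_surface_rpow_le hd0 (θ := 1 / 2) (by norm_num)
  obtain ⟨C₃, hC₃, H₃⟩ := exists_lintegral_truncKernel_mul_le hd0
  refine ⟨2 * C₁ * C₂ * (2 * C₃), by positivity, fun h hh hc G hG => ?_⟩
  have hL := one_le_Cs h
  have hL0 : 0 < Cs h := by linarith
  have := sigmaFinite_surface hh hc
  -- The weights are chosen by homogeneity: integrating `k q` over `Γ × Γ` must give `p`, of degree
  -- `-1/2`, and integrating `k p` over `ℝⁿ` must give `q`, of degree `-d/2`.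
  set p : R (d + 1) → ℝ≥0∞ := fun x =>
    ENNReal.ofReal (|vertical x - h (horizontal x)| ^ (-(1 / 2) : ℝ)) with hp
  set q : R (d + 1) × R (d + 1) → ℝ≥0∞ := fun w =>
    ENNReal.ofReal (‖w.1 - w.2‖ ^ (-(d : ℝ) / 2)) with hq
  have hpm : Measurable p := by
    have h1 := continuous_horizontal (d := d).measurable
    have h2 := continuous_vertical (d := d).measurable
    have h3 := hh.continuous.measurable
    have h4 : Measurable fun x : R (d + 1) => |vertical x - h (horizontal x)| :=
      (continuous_abs.measurable).comp (h2.sub (h3.comp h1))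
    fun_prop
  have hqm : Measurable q := by fun_prop
  -- The first Schur inequality costs `Cs h ^ (2d + 1)`: two area factors and one distance
  -- comparison. The second costs one further factor `Cs h`.
  have hconst : ENNReal.ofReal (2 * C₁ * C₂ * (2 * C₃) * (Cs h ^ (d + 1)) ^ 2) =
      ENNReal.ofReal (2 * C₁ * C₂ * Cs h ^ (2 * d + 1)) * ENNReal.ofReal (2 * C₃ * Cs h) := by
    rw [← ENNReal.ofReal_mul (by positivity)]
    congr 1; ring
  rw [hconst]
  refine schur_test (k := fun x w => ENNReal.ofReal (schurKernel x w)) (p := p) (q := q)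
    (measurable_schurKernel d).ennreal_ofReal hpm hqm hG
    (fun w => ENNReal.ofReal_ne_top) ?_ ?_ ?_
  -- `Real.rpow` gives `0` for base `0` and nonzero exponent, so `q` vanishes exactly on the
  -- diagonal, and the kernel vanishes there too.
  · intro x w hw
    have h0 : ‖w.1 - w.2‖ = 0 := by
      by_contra hne
      have : 0 < ‖w.1 - w.2‖ := lt_of_le_of_ne (norm_nonneg _) (Ne.symm hne)
      have h1 : 0 < ‖w.1 - w.2‖ ^ (-(d : ℝ) / 2) := by positivity
      exact h1.not_ge (ENNReal.ofReal_eq_zero.1 hw)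
    simp only [schurKernel, h0]
    rw [Real.zero_rpow (by linarith)]
    simp
  -- First Schur inequality. With `A = |x - y|`, each half of `k q` is at most `A^{-d}` times
  -- `truncPow` with `γ = 1/2`, `m = 1`; integration in one variable gives `A^{-d-1/2}`, in the
  -- other `t^{-1/2}`.
  · filter_upwards [ae_vertical_ne hh.continuous] with x hx
    set t := |vertical x - h (horizontal x)| with ht
    have ht0 : 0 < t := abs_pos.2 (sub_ne_zero.2 hx)
    have hxy : ∀ y ∈ boundary h, t / Cs h ≤ ‖x - y‖ := by
      intro y hy
      obtain ⟨y, rfl⟩ := boundary_subset_range hh.continuous hy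
      rw [div_le_iff₀' hL0]
      exact abs_vertical_sub_le hh hc x y
    set f : R (d + 1) × R (d + 1) → ℝ≥0∞ := fun w =>
      ENNReal.ofReal ((‖x - w.1‖ ^ d)⁻¹ * truncPow d (1 / 2) 1 ‖x - w.1‖ ‖w.1 - w.2‖) with hf
    have hfm : Measurable f := by
      unfold f truncPow; fun_prop
    have hf1 : ∫⁻ w, f w ∂((surface h).prod (surface h)) ≤
        ENNReal.ofReal (C₁ * C₂ * Cs h ^ (2 * d + 1) * t ^ (-(1 / 2) : ℝ)) := by
      rw [lintegral_prod _ hfm.aemeasurable]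
      calc _ ≤ ∫⁻ y, ENNReal.ofReal (C₁ * Cs h ^ d) *
            ENNReal.ofReal (‖x - y‖ ^ (-((d : ℝ) + 1 / 2))) ∂surface h := by
            refine lintegral_mono_ae ?_
            filter_upwards [ae_surface_mem_boundary h] with y hy
            have hA : 0 < ‖x - y‖ := (by positivity : 0 < t / Cs h).trans_le (hxy y hy)
            simp only [hf]
            simp_rw [ENNReal.ofReal_mul (by positivity : 0 ≤ (‖x - y‖ ^ d)⁻¹)]
            rw [lintegral_const_mul' _ _ ENNReal.ofReal_ne_top]
            refine (mul_le_mul_right (H₁ h hh hc _ hA y) _).trans (le_of_eq ?_)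
            rw [← ENNReal.ofReal_mul (by positivity), ← ENNReal.ofReal_mul (by positivity), neg_add,
              Real.rpow_add hA, Real.rpow_neg hA.le (d : ℝ), Real.rpow_natCast]
            congr 1; ring
        _ ≤ _ := by
            rw [lintegral_const_mul' _ _ ENNReal.ofReal_ne_top]
            refine (mul_le_mul_right (H₂ h hh hc (t / Cs h) (by positivity) x hxy) _).trans ?_
            rw [← ENNReal.ofReal_mul (by positivity)]
            refine ENNReal.ofReal_le_ofReal ?_
            have e : (t / Cs h) ^ (-(1 / 2) : ℝ) ≤ Cs h * t ^ (-(1 / 2) : ℝ) := by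
              rw [Real.div_rpow ht0.le hL0.le, Real.rpow_neg hL0.le, div_inv_eq_mul, mul_comm]
              gcongr
              conv_rhs => rw [← Real.rpow_one (Cs h)]
              exact Real.rpow_le_rpow_of_exponent_le hL (by norm_num)
            calc C₁ * Cs h ^ d * (C₂ * Cs h ^ d * (t / Cs h) ^ (-(1 / 2) : ℝ))
                ≤ C₁ * Cs h ^ d * (C₂ * Cs h ^ d * (Cs h * t ^ (-(1 / 2) : ℝ))) := by gcongr
              _ = _ := by ring
    -- The two terms of the kernel are exchanged by swapping the variables, so only one of them has
    -- to be integrated.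
    have hsplit : ∀ w, ENNReal.ofReal (schurKernel x w) * q w ≤ f w + f w.swap := by
      intro w
      have key : ∀ A : ℝ, ‖w.1 - w.2‖ ^ (-((d : ℝ) + 1) / 2) * truncKernel d ‖w.1 - w.2‖ A *
          ‖w.1 - w.2‖ ^ (-(d : ℝ) / 2) ≤ (A ^ d)⁻¹ * truncPow d (1 / 2) 1 A ‖w.1 - w.2‖ := by
        intro A
        rcases (norm_nonneg (w.1 - w.2)).eq_or_lt with h0 | h0
        · rw [← h0, Real.zero_rpow (by linarith), zero_mul, zero_mul, truncPow,
            Real.zero_rpow (by linarith), zero_mul, mul_zero]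
        · apply le_of_eq
          rw [truncKernel, truncPow, pow_one, show -((d : ℝ) + 1 / 2) =
            -((d : ℝ) + 1) / 2 + -(d : ℝ) / 2 by ring, Real.rpow_add h0]
          ring
      have key1 := key ‖x - w.1‖
      have key2 := key ‖x - w.2‖
      simp only [hf, hq, Prod.fst_swap, Prod.snd_swap]
      rw [← ENNReal.ofReal_mul (schurKernel_nonneg x w), ← ENNReal.ofReal_add
        (mul_nonneg (by positivity) (truncPow_nonneg (norm_nonneg _) (norm_nonneg _)))
        (mul_nonneg (by positivity) (truncPow_nonneg (norm_nonneg _) (norm_nonneg _)))]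
      refine ENNReal.ofReal_le_ofReal ?_
      rw [schurKernel, norm_sub_rev w.2 w.1]
      linarith
    refine (lintegral_mono hsplit).trans ?_
    rw [lintegral_add_left hfm, lintegral_prod_swap]
    refine (add_le_add hf1 hf1).trans (le_of_eq ?_)
    rw [hp, ← ENNReal.ofReal_add (by positivity) (by positivity),
      ← ENNReal.ofReal_mul (by positivity)]
    congr 1; ring
  -- Second Schur inequality: the `x`-integral produces `|y - z|^{1/2}`, which raises the prefactor
  -- `|y - z|^{-(d+1)/2}` to `|y - z|^{-d/2} = q`.
  · have hb1 : ∀ᵐ w ∂(surface h).prod (surface h), w.1 ∈ boundary h :=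
      Measure.quasiMeasurePreserving_fst.ae (ae_surface_mem_boundary h)
    have hb2 : ∀ᵐ w ∂(surface h).prod (surface h), w.2 ∈ boundary h :=
      Measure.quasiMeasurePreserving_snd.ae (ae_surface_mem_boundary h)
    filter_upwards [hb1, hb2] with w hw1 hw2
    rcases (norm_nonneg (w.1 - w.2)).eq_or_lt with h0 | h0
    · have : ∀ x, schurKernel x w = 0 := fun x => by
        rw [schurKernel, ← h0, Real.zero_rpow (by linarith), zero_mul]
      simp [this]
    have key : ∀ y ∈ boundary h, ∫⁻ x, ENNReal.ofReal (truncKernel d ‖w.1 - w.2‖ ‖x - y‖ *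
        |vertical x - h (horizontal x)| ^ (-(1 / 2) : ℝ)) ≤
        ENNReal.ofReal (C₃ * Cs h * ‖w.1 - w.2‖ ^ (1 / 2 : ℝ)) := H₃ h hh hc _ h0
    have hm : ∀ y : R (d + 1), Measurable fun x : R (d + 1) => ENNReal.ofReal
        (truncKernel d ‖w.1 - w.2‖ ‖x - y‖ * |vertical x - h (horizontal x)| ^ (-(1 / 2) : ℝ)) := by
      intro y
      have h1 := continuous_horizontal (d := d).measurable
      have h2 := continuous_vertical (d := d).measurable
      have h3 := hh.continuous.measurable
      have h4 : Measurable fun x : R (d + 1) => |vertical x - h (horizontal x)| :=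
        (continuous_abs.measurable).comp (h2.sub (h3.comp h1))
      unfold truncKernel
      fun_prop
    have e : ∀ x, ENNReal.ofReal (schurKernel x w) * p x =
        ENNReal.ofReal (‖w.1 - w.2‖ ^ (-((d : ℝ) + 1) / 2)) *
        (ENNReal.ofReal (truncKernel d ‖w.1 - w.2‖ ‖x - w.1‖ *
          |vertical x - h (horizontal x)| ^ (-(1 / 2) : ℝ)) +
        ENNReal.ofReal (truncKernel d ‖w.1 - w.2‖ ‖x - w.2‖ *
          |vertical x - h (horizontal x)| ^ (-(1 / 2) : ℝ))) := by
      intro x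
      have h1 := truncKernel_nonneg (d := d) (norm_nonneg (w.1 - w.2)) (norm_nonneg (x - w.1))
      have h2 := truncKernel_nonneg (d := d) (norm_nonneg (w.1 - w.2)) (norm_nonneg (x - w.2))
      rw [hp, ← ENNReal.ofReal_add (by positivity) (by positivity),
        ← ENNReal.ofReal_mul (schurKernel_nonneg x w), ← ENNReal.ofReal_mul (by positivity),
        schurKernel]
      congr 1; ring
    simp_rw [e]
    rw [lintegral_const_mul' _ _ ENNReal.ofReal_ne_top, lintegral_add_left (hm w.1)]
    refine (mul_le_mul_right (add_le_add (key _ hw1) (key _ hw2)) _).trans (le_of_eq ?_)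
    rw [hq, ← ENNReal.ofReal_add (by positivity) (by positivity),
      ← ENNReal.ofReal_mul (by positivity), ← ENNReal.ofReal_mul (by positivity),
      show -(d : ℝ) / 2 = -((d : ℝ) + 1) / 2 + 1 / 2 by ring, Real.rpow_add h0]
    congr 1; ring

/-! ### The perturbed half space -/

lemma eLpNorm_two_sq {X F : Type*} [MeasurableSpace X] [NormedAddCommGroup F] (f : X → F)
    (μ : Measure X) : eLpNorm f 2 μ ^ 2 = ∫⁻ x, ‖f x‖ₑ ^ 2 ∂μ := by
  have := eLpNorm_nnreal_pow_eq_lintegral (f := f) (μ := μ) (p := 2) two_ne_zero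
  simpa using this

lemma eLpNorm_two_le_of_sq_le {X F : Type*} [MeasurableSpace X] [NormedAddCommGroup F] {f : X → F}
    {μ : Measure X} {c : ℝ≥0∞} (h : ∫⁻ x, ‖f x‖ₑ ^ 2 ∂μ ≤ c ^ 2) : eLpNorm f 2 μ ≤ c := by
  rw [← eLpNorm_two_sq] at h
  exact (ENNReal.pow_le_pow_left_iff two_ne_zero).1 h

lemma enorm_sq_eq_sum {n : ℕ} (v : EuclideanSpace ℂ (Fin n)) : ‖v‖ₑ ^ 2 = ∑ j, ‖v j‖ₑ ^ 2 := by
  simp only [← ofReal_norm]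
  rw [← ENNReal.ofReal_pow (norm_nonneg _), EuclideanSpace.norm_sq_eq,
    ENNReal.ofReal_sum_of_nonneg fun j _ => by positivity]
  exact Finset.sum_congr rfl fun j _ => ENNReal.ofReal_pow (norm_nonneg _) 2

lemma norm_gagliardoQuot {n : ℕ} (f : R n → ℂ) (w : R n × R n) :
    ‖gagliardoQuot f w‖ = ‖w.1 - w.2‖ ^ (-(n : ℝ) / 2) * ‖f w.1 - f w.2‖ := by
  rw [gagliardoQuot, norm_div, Complex.norm_real, Real.norm_of_nonneg (by positivity),
    neg_div, Real.rpow_neg (norm_nonneg _), div_eq_inv_mul]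

lemma exists_gagliardoQuot_gradKernel_le {d : ℕ} (hd : 2 ≤ d) :
    ∃ C : ℝ, 0 < C ∧ ∀ (x : R (d + 1)) (w : R (d + 1) × R (d + 1)) (j : Fin (d + 1)),
      x ≠ w.1 → x ≠ w.2 → ‖gagliardoQuot (gradKernel x j) w‖ ≤ C * schurKernel x w := by
  obtain ⟨C, hC, -, H⟩ := exists_gradKernel_le d hd
  refine ⟨C, hC, fun x w j h1 h2 => ?_⟩
  rw [norm_gagliardoQuot, schurKernel, mul_left_comm]
  push_cast
  exact mul_le_mul_of_nonneg_left (H x w.1 w.2 j h1 h2) (by positivity)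

lemma measurable_gagliardoQuot_gradKernel {n : ℕ} (j : Fin n) :
    Measurable fun p : R n × (R n × R n) => gagliardoQuot (gradKernel p.1 j) p.2 := by
  unfold gagliardoQuot
  refine ((measurable_gradKernel j measurable_fst (by fun_prop)).sub
    (measurable_gradKernel j measurable_fst (by fun_prop))).div ?_
  exact Complex.measurable_ofReal.comp (by fun_prop)

/-- Squaring each half of the kernel gives `A^{-2d}` times `truncPow` with `γ = 1`, `m = 2`. One
surface integral leaves `A^{-2d-1}`, integrable over `Γ` at positive distance from `x`. -/
lemma lintegral_schurKernel_sq_lt_top {d : ℕ} (hd : 2 ≤ d) {h : R d → ℝ} (hh : ContDiff ℝ 2 h)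
    (hc : HasCompactSupport h) {x : R (d + 1)} {τ : ℝ} (hτ : 0 < τ)
    (hx : ∀ y ∈ boundary h, τ ≤ ‖x - y‖) :
    ∫⁻ w, ENNReal.ofReal (schurKernel x w ^ 2) ∂((surface h).prod (surface h)) < ∞ := by
  have hd0 : 0 < d := by omega
  have hd2 : (2 : ℝ) ≤ d := by exact_mod_cast hd
  obtain ⟨C₁, hC₁, H₁⟩ := exists_lintegral_surface_truncPow_le hd0 (γ := 1) (m := 2)
    (by norm_num) (by norm_num) (by push_cast; linarith)
  obtain ⟨C₂, hC₂, H₂⟩ := exists_lintegral_surface_rpow_le hd0 (θ := d + 1) (by positivity)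
  have := sigmaFinite_surface hh hc
  have hL := one_le_Cs h
  set f : R (d + 1) × R (d + 1) → ℝ≥0∞ := fun w =>
    ENNReal.ofReal (2 * ((‖x - w.1‖ ^ d)⁻¹) ^ 2 * truncPow d 1 2 ‖x - w.1‖ ‖w.1 - w.2‖) with hf
  have hfm : Measurable f := by
    unfold f truncPow; fun_prop
  have hf1 : ∫⁻ w, f w ∂((surface h).prod (surface h)) < ∞ := by
    rw [lintegral_prod _ hfm.aemeasurable]
    calc _ ≤ ∫⁻ y, ENNReal.ofReal (2 * C₁ * Cs h ^ d) *
          ENNReal.ofReal (‖x - y‖ ^ (-((d : ℝ) + (d + 1)))) ∂surface h := by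
          refine lintegral_mono_ae ?_
          filter_upwards [ae_surface_mem_boundary h] with y hy
          have hA : 0 < ‖x - y‖ := hτ.trans_le (hx y hy)
          simp only [hf]
          simp_rw [ENNReal.ofReal_mul (by positivity : 0 ≤ 2 * ((‖x - y‖ ^ d)⁻¹) ^ 2)]
          rw [lintegral_const_mul' _ _ ENNReal.ofReal_ne_top]
          refine (mul_le_mul_right (H₁ h hh hc _ hA y) _).trans (le_of_eq ?_)
          rw [← ENNReal.ofReal_mul (by positivity), ← ENNReal.ofReal_mul (by positivity), neg_add,
            neg_add, Real.rpow_add hA, Real.rpow_add hA, Real.rpow_neg hA.le (d : ℝ),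
            Real.rpow_natCast]
          congr 1; ring
      _ < ∞ := by
          rw [lintegral_const_mul' _ _ ENNReal.ofReal_ne_top]
          exact ENNReal.mul_lt_top ENNReal.ofReal_lt_top
            ((H₂ h hh hc τ hτ x hx).trans_lt ENNReal.ofReal_lt_top)
  have hsplit : ∀ w, ENNReal.ofReal (schurKernel x w ^ 2) ≤ f w + f w.swap := by
    intro w
    have key : ∀ A : ℝ, (‖w.1 - w.2‖ ^ (-((d : ℝ) + 1) / 2) * truncKernel d ‖w.1 - w.2‖ A) ^ 2 =
        ((A ^ d)⁻¹) ^ 2 * truncPow d 1 2 A ‖w.1 - w.2‖ := by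
      intro A
      rw [truncKernel, truncPow, mul_pow, mul_pow, ← Real.rpow_natCast (_ ^ (_ / 2)),
        ← Real.rpow_mul (norm_nonneg _)]
      push_cast
      rw [div_mul_cancel₀ _ (two_ne_zero' ℝ)]
      ring
    have key1 := key ‖x - w.1‖
    have key2 := key ‖x - w.2‖
    have h1 := truncPow_nonneg (d := d) (γ := 1) (m := 2) (norm_nonneg (x - w.1))
      (norm_nonneg (w.1 - w.2))
    have h2 := truncPow_nonneg (d := d) (γ := 1) (m := 2) (norm_nonneg (x - w.2))
      (norm_nonneg (w.1 - w.2))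
    simp only [hf, Prod.fst_swap, Prod.snd_swap]
    rw [norm_sub_rev w.2 w.1, ← ENNReal.ofReal_add (by positivity) (by positivity)]
    refine ENNReal.ofReal_le_ofReal ?_
    rw [schurKernel, mul_add, mul_assoc 2, mul_assoc 2, ← key1, ← key2, ← mul_add]
    nlinarith [sq_nonneg (‖w.1 - w.2‖ ^ (-((d : ℝ) + 1) / 2) * truncKernel d ‖w.1 - w.2‖ ‖x - w.1‖ -
      ‖w.1 - w.2‖ ^ (-((d : ℝ) + 1) / 2) * truncKernel d ‖w.1 - w.2‖ ‖x - w.2‖)]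
  refine (lintegral_mono hsplit).trans_lt ?_
  rw [lintegral_add_left hfm, lintegral_prod_swap]
  exact ENNReal.add_lt_top.2 ⟨hf1, hf1⟩

/-- The kernel is `O(|x - y|^{-d})`, and its `p`-th power decays like `|x - y|^{-dp}`, with `dp > d`
since `p = 2d/(d-1) > 1`. -/
lemma memLp_gradKernel {d : ℕ} (hd : 2 ≤ d) {h : R d → ℝ} (hh : ContDiff ℝ 2 h)
    (hc : HasCompactSupport h) {x : R (d + 1)} {τ : ℝ} (hτ : 0 < τ)
    (hxτ : ∀ y ∈ boundary h, τ ≤ ‖x - y‖) (j : Fin (d + 1)) :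
    MemLp (gradKernel x j) (ENNReal.ofReal (2 * d / (d - 1))) (surface h) := by
  have hd0 : 0 < d := by omega
  have hd2 : (2 : ℝ) ≤ d := by exact_mod_cast hd
  have hne : ∀ y ∈ boundary h, x ≠ y := by
    rintro y hy rfl
    have := hxτ x hy
    rw [sub_self, norm_zero] at this
    linarith
  have hm1 : Measurable (gradKernel x j) := measurable_gradKernel j measurable_const measurable_id
  obtain ⟨C, hC, H, -⟩ := exists_gradKernel_le d hd
  set p : ℝ := 2 * d / (d - 1) with hp
  have hp1 : 1 < p := by
    rw [hp, one_lt_div (by linarith)]; linarith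
  have hp0 : 0 < p := by linarith
  obtain ⟨C₂, hC₂, H₂⟩ := exists_lintegral_surface_rpow_le hd0 (θ := d * (p - 1))
    (mul_pos (by linarith) (by linarith))
  refine ⟨hm1.aestronglyMeasurable, ?_⟩
  rw [eLpNorm_lt_top_iff_lintegral_rpow_enorm_lt_top (ENNReal.ofReal_pos.2 hp0).ne'
    ENNReal.ofReal_ne_top, ENNReal.toReal_ofReal hp0.le]
  calc _ ≤ ∫⁻ y, ENNReal.ofReal (C ^ p) *
        ENNReal.ofReal (‖x - y‖ ^ (-((d : ℝ) + d * (p - 1)))) ∂surface h := by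
        refine lintegral_mono_ae ?_
        filter_upwards [ae_surface_mem_boundary h] with y hy
        have hA : 0 < ‖x - y‖ := hτ.trans_le (hxτ y hy)
        rw [← ofReal_norm, ENNReal.ofReal_rpow_of_nonneg (norm_nonneg _) hp0.le,
          ← ENNReal.ofReal_mul (by positivity)]
        refine ENNReal.ofReal_le_ofReal ?_
        refine (Real.rpow_le_rpow (norm_nonneg _) (H x y j (hne y hy)) hp0.le).trans (le_of_eq ?_)
        rw [Real.mul_rpow hC.le (by positivity), ← Real.rpow_natCast, ← Real.rpow_neg hA.le,
          ← Real.rpow_mul hA.le]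
        congr 2; ring
    _ < ∞ := by
        rw [lintegral_const_mul' _ _ ENNReal.ofReal_ne_top]
        exact ENNReal.mul_lt_top ENNReal.ofReal_lt_top
          ((H₂ h hh hc τ hτ x hxτ).trans_lt ENNReal.ofReal_lt_top)

lemma memLp_gagliardoQuot_gradKernel {d : ℕ} (hd : 2 ≤ d) {h : R d → ℝ} (hh : ContDiff ℝ 2 h)
    (hc : HasCompactSupport h) {x : R (d + 1)} {τ : ℝ} (hτ : 0 < τ)
    (hxτ : ∀ y ∈ boundary h, τ ≤ ‖x - y‖) (j : Fin (d + 1)) :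
    MemLp (gagliardoQuot (gradKernel x j)) 2 ((surface h).prod (surface h)) := by
  have hne : ∀ y ∈ boundary h, x ≠ y := by
    rintro y hy rfl
    have := hxτ x hy
    rw [sub_self, norm_zero] at this
    linarith
  have := sigmaFinite_surface hh hc
  obtain ⟨C, hC, H⟩ := exists_gagliardoQuot_gradKernel_le hd
  refine ⟨((measurable_gagliardoQuot_gradKernel j).comp
    measurable_prodMk_left).aestronglyMeasurable, ?_⟩
  refine (ENNReal.pow_lt_top_iff.1 (?_ : eLpNorm _ 2 _ ^ 2 < ∞)).resolve_right two_ne_zero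
  rw [eLpNorm_two_sq]
  have hb1 : ∀ᵐ w ∂(surface h).prod (surface h), w.1 ∈ boundary h :=
    Measure.quasiMeasurePreserving_fst.ae (ae_surface_mem_boundary h)
  have hb2 : ∀ᵐ w ∂(surface h).prod (surface h), w.2 ∈ boundary h :=
    Measure.quasiMeasurePreserving_snd.ae (ae_surface_mem_boundary h)
  calc _ ≤ ∫⁻ w, ENNReal.ofReal (C ^ 2) * ENNReal.ofReal (schurKernel x w ^ 2)
        ∂((surface h).prod (surface h)) := by
        refine lintegral_mono_ae ?_
        filter_upwards [hb1, hb2] with w h1 h2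
        rw [← ofReal_norm, ← ENNReal.ofReal_pow (norm_nonneg _),
          ← ENNReal.ofReal_mul (by positivity), ← mul_pow]
        exact ENNReal.ofReal_le_ofReal (pow_le_pow_left₀ (norm_nonneg _)
          (H x w j (hne _ h1) (hne _ h2)) 2)
    _ < ∞ := by
        rw [lintegral_const_mul' _ _ ENNReal.ofReal_ne_top]
        exact ENNReal.mul_lt_top ENNReal.ofReal_lt_top
          (lintegral_schurKernel_sq_lt_top hd hh hc hτ hxτ)

lemma gradKernel_mem_hHalfSubmodule {d : ℕ} (hd : 2 ≤ d) {h : R d → ℝ} (hh : ContDiff ℝ 2 h)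
    (hc : HasCompactSupport h) {x : R (d + 1)} (hx : x ∉ boundary h) (j : Fin (d + 1)) :
    gradKernel x j ∈ hHalfSubmodule h := by
  obtain ⟨τ, hτ, hb⟩ := Metric.isOpen_iff.1 (isClosed_frontier.isOpen_compl) x hx
  have hxτ : ∀ y ∈ boundary h, τ ≤ ‖x - y‖ := by
    intro y hy
    by_contra! hlt
    exact hb (by rwa [Metric.mem_ball, dist_comm, dist_eq_norm]) hy
  exact ⟨memLp_gradKernel hd hh hc hτ hxτ j, memLp_gagliardoQuot_gradKernel hd hh hc hτ hxτ j⟩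

/-- A functional on a space whose seminorm is induced by a linear map into a Hilbert space is
represented by an element of that Hilbert space. -/
lemma exists_inner_representative {V H : Type*} [SeminormedAddCommGroup V] [NormedSpace ℂ V]
    [NormedAddCommGroup H] [InnerProductSpace ℂ H] [CompleteSpace H] (T : V →ₗ[ℂ] H)
    (hT : ∀ v, ‖T v‖ = ‖v‖) (φ : V →L[ℂ] ℂ) :
    ∃ G : H, ‖G‖ ≤ ‖φ‖ ∧ ∀ v, φ v = inner ℂ G (T v) := by
  -- A linear section of `T` over its range transports `φ` to the range without increasing its norm,
  -- because `T` preserves the seminorm; Hahn–Banach and Riesz then apply.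
  obtain ⟨s, hs⟩ := T.rangeRestrict.exists_rightInverse_of_surjective T.range_rangeRestrict
  have hs' : ∀ u : LinearMap.range T, T (s u) = u := fun u =>
    congrArg Subtype.val (LinearMap.congr_fun hs u)
  have hbound : ∀ u : LinearMap.range T, ‖(φ.toLinearMap ∘ₗ s) u‖ ≤ ‖φ‖ * ‖u‖ := by
    intro u
    refine (φ.le_opNorm (s u)).trans (le_of_eq ?_)
    rw [← hT, hs', Submodule.coe_norm]
  obtain ⟨ψ, hψ, hψn⟩ := exists_extension_norm_eq (𝕜 := ℂ) (LinearMap.range T)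
    (LinearMap.mkContinuous (φ.toLinearMap ∘ₗ s) ‖φ‖ hbound)
  refine ⟨(InnerProductSpace.toDual ℂ H).symm ψ, ?_, fun v => ?_⟩
  · rw [LinearIsometryEquiv.norm_map, hψn]
    exact LinearMap.mkContinuous_norm_le _ (norm_nonneg _) _
  · rw [InnerProductSpace.toDual_symm_apply]
    have h1 := hψ ⟨T v, LinearMap.mem_range_self T v⟩
    simp only [LinearMap.mkContinuous_apply, LinearMap.comp_apply,
      ContinuousLinearMap.coe_coe] at h1
    -- The vector `v` and the chosen preimage of `T v` differ by a vector of seminorm zero, on which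
    -- the bounded functional `φ` vanishes.
    rw [h1, ← sub_eq_zero, ← map_sub]
    have h2 : ‖v - s ⟨T v, LinearMap.mem_range_self T v⟩‖ = 0 := by
      rw [← hT, map_sub, hs', sub_self, norm_zero]
    have h3 := φ.le_opNorm (v - s ⟨T v, LinearMap.mem_range_self T v⟩)
    rw [h2, mul_zero] at h3
    exact norm_le_zero_iff.1 h3

/-- All summands of `layerConst` are nonnegative, and the last is `Cs h ^ (n + 5)` times factors
that are at least `1`. -/
lemma Cs_pow_le_layerConst {d : ℕ} (h : R d → ℝ) {ρ : ℝ} (hρ : 0 < ρ) :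
    Cs h ^ (d + 1) ≤ layerConst h ρ := by
  have hL := one_le_Cs h
  have hR : 0 ≤ supportRadius h := Real.sInf_nonneg fun r hr => hr.1.le
  have hH : 0 ≤ hessSup h := Real.iSup_nonneg fun y => norm_nonneg _
  have hC : 1 ≤ C1 h := by
    unfold C1; linarith [mul_nonneg hR hH]
  have h1 : Cs h ^ (d + 1) ≤ Cs h ^ ((d + 1 : ℝ) + 5) := by
    rw [← Real.rpow_natCast]
    refine Real.rpow_le_rpow_of_exponent_le hL ?_
    push_cast; linarith
  have h2 : 1 ≤ C1 h ^ 2 := one_le_pow₀ hC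
  have h3 : 1 ≤ 1 + supportRadius h ^ (((d + 1 : ℝ)) / 2) :=
    le_add_of_nonneg_right (by positivity)
  have h4 : 0 < Cs h ^ ((d + 1 : ℝ) + 5) := by positivity
  have h5 : Cs h ^ ((d + 1 : ℝ) + 5) ≤ Cs h ^ ((d + 1 : ℝ) + 5) * C1 h ^ 2 *
      (1 + supportRadius h ^ (((d + 1 : ℝ)) / 2)) := by
    rw [mul_assoc]
    exact le_mul_of_one_le_right h4.le (one_le_mul_of_one_le_of_one_le h2 h3)
  unfold layerConst
  refine h1.trans (h5.trans (le_add_of_nonneg_left ?_))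
  have : 0 ≤ hessSup h + ρ⁻¹ := by positivity
  positivity

/-- Duality replaces the pairing with `g` by an absolutely convergent integral against `G ∈ L²(Γ ×
Γ)`, to which the Schur bound applies. -/
theorem perturbedHalfSpace_estimate {d : ℕ} (hd : 2 ≤ d) :
    ∃ C : ℝ, 0 < C ∧ ∀ h : R d → ℝ, ContDiff ℝ 2 h → HasCompactSupport h →
      ∀ g : LinftyHMinusHalf h, MemLp (gradSingleLayer g) 2 volume ∧
        eLpNorm (gradSingleLayer g) 2 volume ≤
          ENNReal.ofReal (C * Cs h ^ (d + 1) * ‖g.toDual‖) := by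
  obtain ⟨C₁, hC₁, H₁⟩ := exists_lintegral_schurKernel_le hd
  obtain ⟨C₂, hC₂, H₂⟩ := exists_gagliardoQuot_gradKernel_le hd
  -- The factors are the number of components, the square of the pointwise kernel constant, and the
  -- Schur constant.
  refine ⟨√((d + 1) * C₂ ^ 2 * C₁), by positivity, fun h hh hc g => ?_⟩
  have hL := one_le_Cs h
  have := sigmaFinite_surface hh hc
  set ν := (surface h).prod (surface h) with hν
  obtain ⟨G, hGn, hG⟩ := exists_inner_representative (HHalf.toL2 h) (fun v => rfl) g.toDual
  have hGs : StronglyMeasurable G := Lp.stronglyMeasurable G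
  have hGm : Measurable fun w => ‖G w‖ₑ := hGs.enorm
  have hb1 : ∀ᵐ w ∂ν, w.1 ∈ boundary h :=
    Measure.quasiMeasurePreserving_fst.ae (ae_surface_mem_boundary h)
  have hb2 : ∀ᵐ w ∂ν, w.2 ∈ boundary h :=
    Measure.quasiMeasurePreserving_snd.ae (ae_surface_mem_boundary h)
  have hF : ∀ x ∉ boundary h, ∀ j, gradSingleLayer g x j =
      ∫ w, inner ℂ (G w) (gagliardoQuot (gradKernel x j) w) ∂ν := by
    intro x hx j
    have hk := gradKernel_mem_hHalfSubmodule hd hh hc hx j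
    simp only [gradSingleLayer, dif_pos hk]
    refine (hG _).trans ?_
    rw [L2.inner_def]
    refine integral_congr_ae ?_
    filter_upwards [hk.2.coeFn_toLp] with w hw
    rw [← hw]
    rfl
  have hxb : ∀ᵐ x : R (d + 1), x ∉ boundary h := measure_eq_zero_iff_ae_notMem.1
    (volume_boundary hh.continuous)
  have hle : ∀ x ∉ boundary h, ∀ j, ‖gradSingleLayer g x j‖ₑ ≤
      ENNReal.ofReal C₂ * ∫⁻ w, ENNReal.ofReal (schurKernel x w) * ‖G w‖ₑ ∂ν := by
    intro x hx j
    rw [hF x hx j, ← lintegral_const_mul' _ _ ENNReal.ofReal_ne_top]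
    refine (enorm_integral_le_lintegral_enorm _).trans (lintegral_mono_ae ?_)
    filter_upwards [hb1, hb2] with w h1 h2
    have h3 := H₂ x w j (fun e => hx (e ▸ h1)) (fun e => hx (e ▸ h2))
    rw [← mul_assoc, ← ENNReal.ofReal_mul hC₂.le, ← ofReal_norm, ← ofReal_norm,
      ← ENNReal.ofReal_mul (mul_nonneg hC₂.le (schurKernel_nonneg x w))]
    refine ENNReal.ofReal_le_ofReal ((norm_inner_le_norm _ _).trans ?_)
    rw [mul_comm]
    exact mul_le_mul_of_nonneg_right h3 (norm_nonneg _)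
  -- The potential agrees off the null set `Γ` with a parameter integral of a jointly measurable
  -- function.
  have hmeas : AEStronglyMeasurable (gradSingleLayer g) volume := by
    have hcoord : ∀ j, StronglyMeasurable fun x : R (d + 1) =>
        ∫ w, inner ℂ (G w) (gagliardoQuot (gradKernel x j) w) ∂ν := by
      intro j
      refine StronglyMeasurable.integral_prod_right
        (f := fun x w => inner ℂ (G w) (gagliardoQuot (gradKernel x j) w)) ?_
      exact StronglyMeasurable.inner (𝕜 := ℂ) (hGs.comp_measurable measurable_snd)
        (measurable_gagliardoQuot_gradKernel j).stronglyMeasurable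
    have hvec : Measurable fun x : R (d + 1) => (WithLp.toLp 2 fun j =>
        ∫ w, inner ℂ (G w) (gagliardoQuot (gradKernel x j) w) ∂ν :
          EuclideanSpace ℂ (Fin (d + 1))) :=
      (PiLp.continuous_toLp 2 _).measurable.comp
        (measurable_pi_lambda _ fun j => (hcoord j).measurable)
    refine hvec.aestronglyMeasurable.congr ?_
    filter_upwards [hxb] with x hx
    ext j
    exact (hF x hx j).symm
  have hGint : ∫⁻ w, ‖G w‖ₑ ^ 2 ∂ν ≤ ENNReal.ofReal (‖g.toDual‖ ^ 2) := by
    rw [← eLpNorm_two_sq, ENNReal.ofReal_pow (norm_nonneg _)]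
    refine pow_le_pow_left' ?_ 2
    rw [← ENNReal.ofReal_toReal (Lp.eLpNorm_ne_top G), ← Lp.norm_def]
    exact ENNReal.ofReal_le_ofReal hGn
  have hnorm : eLpNorm (gradSingleLayer g) 2 volume ≤
      ENNReal.ofReal (√((d + 1) * C₂ ^ 2 * C₁) * Cs h ^ (d + 1) * ‖g.toDual‖) := by
    refine eLpNorm_two_le_of_sq_le ?_
    calc _ ≤ ∫⁻ x, ENNReal.ofReal ((d + 1) * C₂ ^ 2) *
          (∫⁻ w, ENNReal.ofReal (schurKernel x w) * ‖G w‖ₑ ∂ν) ^ 2 := by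
          refine lintegral_mono_ae ?_
          filter_upwards [hxb] with x hx
          rw [enorm_sq_eq_sum]
          refine (Finset.sum_le_sum fun j _ => pow_le_pow_left' (hle x hx j) 2).trans (le_of_eq ?_)
          rw [Finset.sum_const, Finset.card_univ, Fintype.card_fin, nsmul_eq_mul, mul_pow,
            ← mul_assoc, ENNReal.ofReal_mul (by positivity), ENNReal.ofReal_pow hC₂.le]
          congr 2
          rw [← ENNReal.ofReal_natCast]
          push_cast; rfl
      _ ≤ ENNReal.ofReal ((d + 1) * C₂ ^ 2) * (ENNReal.ofReal (C₁ * (Cs h ^ (d + 1)) ^ 2) *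
          ENNReal.ofReal (‖g.toDual‖ ^ 2)) := by
          rw [lintegral_const_mul' _ _ ENNReal.ofReal_ne_top]
          gcongr
          exact (H₁ h hh hc _ hGm).trans (by gcongr)
      _ = _ := by
          rw [← ENNReal.ofReal_mul (by positivity), ← ENNReal.ofReal_mul (by positivity),
            ← ENNReal.ofReal_pow (by positivity), mul_pow, mul_pow, Real.sq_sqrt (by positivity)]
          congr 1; ring
  exact ⟨⟨hmeas, hnorm.trans_lt ENNReal.ofReal_lt_top⟩, hnorm⟩

/-! ### The subordination formula -/

/-- The map `Ψ(u) = bu - a/u` carries `(0, ∞)` bijectively onto `ℝ`, so the Gaussian integral is `∫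
(b + a/u²) e^{-Ψ²} du`. The inversion `u ↦ a/(bu)` sends `Ψ` to `-Ψ` and exchanges the two summands,
so each equals half of `√π`. -/
lemma integral_exp_neg_sq_sub_div {a b : ℝ} (ha : 0 < a) (hb : 0 < b) :
    IntegrableOn (fun u => Real.exp (-(b * u - a / u) ^ 2)) (Set.Ioi 0) ∧
      ∫ u in Set.Ioi (0 : ℝ), Real.exp (-(b * u - a / u) ^ 2) = √Real.pi / (2 * b) := by
  set Ψ : ℝ → ℝ := fun u => b * u - a / u with hΨ
  set g : ℝ → ℝ := fun v => Real.exp (-v ^ 2) with hg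
  have hgint : Integrable g := by
    simpa [g] using integrable_exp_neg_mul_sq (zero_lt_one' ℝ)
  have hgval : ∫ v, g v = √Real.pi := by
    simpa [g] using integral_gaussian 1
  have hd : ∀ u ∈ Set.Ioi (0 : ℝ), HasDerivWithinAt Ψ (b + a / u ^ 2) (Set.Ioi 0) u := by
    intro u hu
    have hu0 : u ≠ 0 := (Set.mem_Ioi.1 hu).ne'
    have h1 := ((hasDerivAt_id u).const_mul b).sub ((hasDerivAt_inv hu0).const_mul a)
    refine (h1.congr_deriv ?_).hasDerivWithinAt
    field_simp
    ring
  have hmono : StrictMonoOn Ψ (Set.Ioi 0) := by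
    intro u hu v hv huv
    have hu0 : 0 < u := hu
    have h1 : a / v < a / u := div_lt_div_of_pos_left ha hu0 huv
    have h2 : b * u < b * v := mul_lt_mul_of_pos_left huv hb
    simp only [hΨ]; linarith
  have himg : Ψ '' Set.Ioi 0 = Set.univ := by
    refine Set.eq_univ_of_forall fun v => ?_
    have h0 : 0 < v ^ 2 + 4 * a * b := by positivity
    have hs := Real.sq_sqrt h0.le
    have hpos : 0 < v + √(v ^ 2 + 4 * a * b) := by
      have : |v| < √(v ^ 2 + 4 * a * b) := by
        rw [← Real.sqrt_sq_eq_abs]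
        exact Real.sqrt_lt_sqrt (sq_nonneg v) (lt_add_of_pos_right _ (by positivity))
      linarith [neg_abs_le v]
    -- The positive root of `b u² - v u - a = 0`.
    refine ⟨(v + √(v ^ 2 + 4 * a * b)) / (2 * b), Set.mem_Ioi.2 (by positivity), ?_⟩
    have e : a / ((v + √(v ^ 2 + 4 * a * b)) / (2 * b)) = (√(v ^ 2 + 4 * a * b) - v) / 2 := by
      rw [div_div_eq_mul_div, div_eq_iff hpos.ne']
      linarith
    simp only [hΨ, e]
    field_simp
    ring
  have hcov := integral_image_eq_integral_abs_deriv_smul measurableSet_Ioi hd hmono.injOn g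
  have hcovi := (integrableOn_image_iff_integrableOn_abs_deriv_smul measurableSet_Ioi hd
    hmono.injOn g).1 (by rw [himg]; exact hgint.integrableOn)
  rw [himg, setIntegral_univ, hgval] at hcov
  have hΨm : Measurable Ψ := by fun_prop
  have hgm : Measurable g := by fun_prop
  have hI1 : IntegrableOn (fun u => b * g (Ψ u)) (Set.Ioi 0) := by
    refine Integrable.mono' hcovi (by fun_prop) ?_
    filter_upwards [ae_restrict_mem measurableSet_Ioi] with u hu
    have hu0 : 0 < u := hu
    rw [Real.norm_of_nonneg (by positivity), abs_of_pos (by positivity), smul_eq_mul]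
    gcongr
    exact le_add_of_nonneg_right (by positivity)
  have hI2 : IntegrableOn (fun u => a / u ^ 2 * g (Ψ u)) (Set.Ioi 0) := by
    refine Integrable.mono' hcovi (by fun_prop) ?_
    filter_upwards [ae_restrict_mem measurableSet_Ioi] with u hu
    have hu0 : 0 < u := hu
    rw [Real.norm_of_nonneg (by positivity), abs_of_pos (by positivity), smul_eq_mul]
    gcongr
    exact le_add_of_nonneg_left (by positivity)
  have hsum : √Real.pi =
      (∫ u in Set.Ioi (0 : ℝ), b * g (Ψ u)) + ∫ u in Set.Ioi (0 : ℝ), a / u ^ 2 * g (Ψ u) := by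
    rw [hcov, ← integral_add hI1 hI2]
    refine setIntegral_congr_fun measurableSet_Ioi fun u hu => ?_
    have hu0 : 0 < u := hu
    simp only [smul_eq_mul]
    rw [abs_of_pos (by positivity)]
    ring
  have hd2 : ∀ u ∈ Set.Ioi (0 : ℝ),
      HasDerivWithinAt (fun u => a / b * u⁻¹) (a / b * (-(u ^ 2)⁻¹)) (Set.Ioi 0) u := fun u hu =>
    ((hasDerivAt_inv (Set.mem_Ioi.1 hu).ne').const_mul (a / b)).hasDerivWithinAt
  have hinj2 : Set.InjOn (fun u => a / b * u⁻¹) (Set.Ioi 0) := by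
    intro u _ v _ huv
    have : a / b ≠ 0 := by positivity
    exact inv_injective (mul_left_cancel₀ this huv)
  have himg2 : (fun u => a / b * u⁻¹) '' Set.Ioi 0 = Set.Ioi 0 := by
    ext v
    constructor
    · rintro ⟨u, hu, rfl⟩
      have hu0 : 0 < u := hu
      exact Set.mem_Ioi.2 (by positivity)
    · intro hv
      have hv0 : 0 < v := hv
      exact ⟨a / b * v⁻¹, Set.mem_Ioi.2 (by positivity), by field_simp⟩
  have hcov2 := integral_image_eq_integral_abs_deriv_smul measurableSet_Ioi hd2 hinj2
    (fun u => b * g (Ψ u))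
  rw [himg2] at hcov2
  have hsym : ∫ u in Set.Ioi (0 : ℝ), b * g (Ψ u) =
      ∫ u in Set.Ioi (0 : ℝ), a / u ^ 2 * g (Ψ u) := by
    rw [hcov2]
    refine setIntegral_congr_fun measurableSet_Ioi fun u hu => ?_
    have hu0 : 0 < u := hu
    have h1 : Ψ (a / b * u⁻¹) = -Ψ u := by
      simp only [hΨ]; field_simp; ring
    have h2 : |a / b * (-(u ^ 2)⁻¹)| = a / b * (u ^ 2)⁻¹ := by
      rw [mul_neg, abs_neg, abs_of_pos (by positivity)]
    simp only [smul_eq_mul, h1, h2, hg, neg_sq]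
    field_simp
  rw [← hsym, integral_const_mul] at hsum
  refine ⟨?_, ?_⟩
  · have := hI1.const_mul b⁻¹
    simp only [inv_mul_cancel_left₀ hb.ne'] at this
    exact this
  · change ∫ u in Set.Ioi (0 : ℝ), g (Ψ u) = _
    rw [hsum]
    field_simp
    ring

/-- Subordination of the Poisson semigroup to the Gaussian. -/
lemma integral_exp_neg_subordination {a b : ℝ} (ha : 0 < a) (hb : 0 < b) :
    IntegrableOn (fun u => Real.exp (-a ^ 2 / u ^ 2) * Real.exp (-b ^ 2 * u ^ 2)) (Set.Ioi 0) ∧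
      ∫ u in Set.Ioi (0 : ℝ), Real.exp (-a ^ 2 / u ^ 2) * Real.exp (-b ^ 2 * u ^ 2) =
        √Real.pi / (2 * b) * Real.exp (-(2 * a * b)) := by
  obtain ⟨h1, h2⟩ := integral_exp_neg_sq_sub_div ha hb
  have e : ∀ u ∈ Set.Ioi (0 : ℝ), Real.exp (-a ^ 2 / u ^ 2) * Real.exp (-b ^ 2 * u ^ 2) =
      Real.exp (-(b * u - a / u) ^ 2) * Real.exp (-(2 * a * b)) := by
    intro u hu
    have hu0 : u ≠ 0 := (Set.mem_Ioi.1 hu).ne'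
    rw [← Real.exp_add, ← Real.exp_add]
    congr 1
    field_simp
    ring
  refine ⟨(integrableOn_congr_fun e measurableSet_Ioi).2 (h1.mul_const _), ?_⟩
  rw [setIntegral_congr_fun measurableSet_Ioi e, integral_mul_const, h2]

/-! ### The partial Fourier representation of the fundamental solution -/

lemma integrable_norm_rpow_mul_exp {d : ℕ} (hd : 0 < d) {s c : ℝ} (hs : -(d : ℝ) < s) (hc : 0 < c) :
    Integrable fun ξ : R d => ‖ξ‖ ^ s * Real.exp (-c * ‖ξ‖) := by
  have : Nonempty (Fin d) := ⟨⟨0, hd⟩⟩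
  rw [integrable_fun_norm_addHaar volume (f := fun y : ℝ => y ^ s * Real.exp (-c * y)),
    finrank_euclideanSpace_fin]
  have h1 := integrableOn_rpow_mul_exp_neg_mul_rpow (s := d - 1 + s) (p := 1) (b := c)
    (by linarith) one_pos hc
  refine (integrableOn_congr_fun (fun y hy => ?_) measurableSet_Ioi).2 h1
  have hy0 : 0 < y := hy
  rw [Real.rpow_one, Real.rpow_add hy0, smul_eq_mul, mul_assoc]
  congr 1
  rw [← Real.rpow_natCast, Nat.cast_sub hd, Nat.cast_one]

/-- The function `e^{2πi⟨ξ, x'⟩ - 2π xₙ |ξ|}`, harmonic in `x` for each `ξ`. -/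
def poissonWave {d : ℕ} (x : R (d + 1)) (ξ : R d) : ℂ :=
  Complex.exp (2 * Real.pi * Complex.I * (inner ℝ ξ (horizontal x) : ℝ)) *
    (Real.exp (-(2 * Real.pi * vertical x) * ‖ξ‖) : ℝ)

lemma norm_poissonWave {d : ℕ} (x : R (d + 1)) (ξ : R d) :
    ‖poissonWave x ξ‖ = Real.exp (-(2 * Real.pi * vertical x) * ‖ξ‖) := by
  rw [poissonWave, norm_mul, Complex.norm_real, Real.norm_of_nonneg (Real.exp_nonneg _),
    show (2 * Real.pi * Complex.I * (inner ℝ ξ (horizontal x) : ℝ) : ℂ) =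
      ((2 * Real.pi * inner ℝ ξ (horizontal x) : ℝ) : ℂ) * Complex.I by push_cast; ring,
    Complex.norm_exp_ofReal_mul_I, one_mul]

lemma continuous_poissonWave {d : ℕ} :
    Continuous fun p : R (d + 1) × R d => poissonWave p.1 p.2 := by
  have h1 := continuous_horizontal (d := d)
  have h2 := continuous_vertical (d := d)
  unfold poissonWave
  fun_prop

lemma integral_gaussian_wave {d : ℕ} (y : R d) {u : ℝ} (hu : 0 < u) :
    ∫ ξ : R d, Complex.exp (2 * Real.pi * Complex.I * (inner ℝ ξ y : ℝ)) *
        (Real.exp (-(Real.pi * ‖ξ‖) ^ 2 * u ^ 2) : ℝ) =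
      (((√Real.pi * u) ^ d)⁻¹ * Real.exp (-‖y‖ ^ 2 / u ^ 2) : ℝ) := by
  have hb : 0 < ((Real.pi ^ 2 * u ^ 2 : ℝ) : ℂ).re := by
    rw [Complex.ofReal_re]; positivity
  have h := GaussianFourier.integral_cexp_neg_mul_sq_norm_add (V := R d) hb
    (2 * Real.pi * Complex.I) y
  rw [finrank_euclideanSpace_fin] at h
  refine Eq.trans (integral_congr_ae (Filter.Eventually.of_forall fun ξ => ?_)) (h.trans ?_)
  · simp only
    rw [Complex.ofReal_exp, ← Complex.exp_add, real_inner_comm]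
    congr 1
    push_cast; ring
  · push_cast
    congr 1
    · have e : ((Real.pi : ℂ) / (Real.pi ^ 2 * u ^ 2)) = (((√Real.pi * u) ^ 2)⁻¹ : ℝ) := by
        rw [mul_pow, Real.sq_sqrt Real.pi_pos.le]
        have h1 : (Real.pi : ℂ) ≠ 0 := by exact_mod_cast Real.pi_ne_zero
        have h2 : (u : ℂ) ≠ 0 := by exact_mod_cast hu.ne'
        push_cast
        field_simp
      have e2 : ((d : ℂ) / 2) = ((d / 2 : ℝ) : ℂ) := by push_cast; ring
      rw [e, e2, ← Complex.ofReal_cpow (by positivity), Real.inv_rpow (by positivity),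
        ← Real.rpow_natCast, ← Real.rpow_mul (by positivity)]
      push_cast
      rw [mul_div_cancel₀ _ (two_ne_zero' ℝ), Real.rpow_natCast]
      push_cast; rfl
    · congr 1
      have h1 : (Real.pi : ℂ) ≠ 0 := by exact_mod_cast Real.pi_ne_zero
      have h2 : (u : ℂ) ≠ 0 := by exact_mod_cast hu.ne'
      rw [mul_pow, mul_pow, Complex.I_sq]
      field_simp
      ring

lemma integrable_inv_norm_mul_exp {d : ℕ} (hd : 2 ≤ d) {c : ℝ} (hc : 0 < c) :
    Integrable fun ξ : R d => ‖ξ‖⁻¹ * Real.exp (-c * ‖ξ‖) := by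
  have hd2 : (2 : ℝ) ≤ d := by exact_mod_cast hd
  simpa only [Real.rpow_neg_one] using
    integrable_norm_rpow_mul_exp (d := d) (by omega) (s := -1) (by linarith) hc

/-- Subordination with `a = xₙ` and `b = π|ξ|` writes `|ξ|⁻¹ e^{-2πxₙ|ξ|}` as a superposition of
Gaussians in `ξ`. After Fubini, `e^{-xₙ²/u²}` and the transformed Gaussian `e^{-|x'|²/u²}` combine
to a radial function of `x`. -/
lemma integral_inv_norm_mul_poissonWave {d : ℕ} (hd : 2 ≤ d) {x : R (d + 1)}
    (hx : 0 < vertical x) :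
    ∫ ξ : R d, ((‖ξ‖⁻¹ : ℝ) : ℂ) * poissonWave x ξ =
      ∫ u in Set.Ioi (0 : ℝ),
        ((2 * √Real.pi * ((√Real.pi * u) ^ d)⁻¹ * Real.exp (-‖x‖ ^ 2 / u ^ 2) : ℝ) : ℂ) := by
  have : Nonempty (Fin d) := ⟨⟨0, by omega⟩⟩
  set t := vertical x with ht
  set k : R d → ℝ → ℝ := fun ξ u =>
    2 * √Real.pi * (Real.exp (-t ^ 2 / u ^ 2) * Real.exp (-(Real.pi * ‖ξ‖) ^ 2 * u ^ 2)) with hk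
  set e : R d → ℂ := fun ξ =>
    Complex.exp (2 * Real.pi * Complex.I * (inner ℝ ξ (horizontal x) : ℝ)) with he
  have hen : ∀ ξ, ‖e ξ‖ = 1 := by
    intro ξ
    simp only [he]
    rw [show (2 * Real.pi * Complex.I * (inner ℝ ξ (horizontal x) : ℝ) : ℂ) =
      ((2 * Real.pi * inner ℝ ξ (horizontal x) : ℝ) : ℂ) * Complex.I by push_cast; ring,
      Complex.norm_exp_ofReal_mul_I]
  have hsub : ∀ ξ : R d, ξ ≠ 0 → IntegrableOn (k ξ) (Set.Ioi 0) ∧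
      ∫ u in Set.Ioi (0 : ℝ), k ξ u = ‖ξ‖⁻¹ * Real.exp (-(2 * Real.pi * t) * ‖ξ‖) := by
    intro ξ hξ
    have hξ0 : 0 < ‖ξ‖ := norm_pos_iff.2 hξ
    obtain ⟨h1, h2⟩ := integral_exp_neg_subordination hx (mul_pos Real.pi_pos hξ0)
    refine ⟨h1.const_mul _, ?_⟩
    simp only [hk]
    rw [integral_const_mul, h2, ← mul_assoc]
    congr 1
    · have := Real.mul_self_sqrt Real.pi_pos.le
      have hpi := Real.pi_pos
      field_simp
      rw [Real.sq_sqrt hpi.le]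
    · congr 1; ring
  have hkm : Measurable (Function.uncurry fun ξ u => e ξ * (k ξ u : ℂ)) := by
    have h1 : Measurable e := by
      have : Continuous e := by
        simp only [he]; fun_prop
      exact this.measurable
    have h2 : Measurable (Function.uncurry k) := by
      simp only [hk, Function.uncurry_def]; fun_prop
    exact (h1.comp measurable_fst).mul (Complex.measurable_ofReal.comp h2)
  have hkn : ∀ ξ u, ‖e ξ * (k ξ u : ℂ)‖ = k ξ u := by
    intro ξ u
    rw [norm_mul, hen, one_mul, Complex.norm_real, Real.norm_of_nonneg (by positivity)]
  have hne : ∀ᵐ ξ : R d, ξ ≠ 0 := Measure.ae_ne volume 0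
  -- The `u`-integral of the absolute value is `|ξ|⁻¹ e^{-2πt|ξ|}` again, and `|ξ|⁻¹` is locally
  -- integrable since `d ≥ 2`.
  have hint : Integrable (Function.uncurry fun ξ u => e ξ * (k ξ u : ℂ))
      (volume.prod (volume.restrict (Set.Ioi (0 : ℝ)))) := by
    rw [integrable_prod_iff hkm.aestronglyMeasurable]
    refine ⟨?_, ?_⟩
    · filter_upwards [hne] with ξ hξ
      exact ((hsub ξ hξ).1.ofReal).const_mul (e ξ)
    · refine (integrable_inv_norm_mul_exp hd
        (by positivity : 0 < 2 * Real.pi * t)).congr ?_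
      filter_upwards [hne] with ξ hξ
      simp only [Function.uncurry_apply_pair, hkn]
      exact (hsub ξ hξ).2.symm
  calc _ = ∫ ξ, ∫ u in Set.Ioi (0 : ℝ), e ξ * (k ξ u : ℂ) := by
        refine integral_congr_ae ?_
        filter_upwards [hne] with ξ hξ
        rw [integral_const_mul, integral_complex_ofReal, (hsub ξ hξ).2, poissonWave]
        push_cast
        ring
    _ = ∫ u in Set.Ioi (0 : ℝ), ∫ ξ, e ξ * (k ξ u : ℂ) := integral_integral_swap hint
    _ = _ := by
        refine setIntegral_congr_fun measurableSet_Ioi fun u hu => ?_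
        have h1 := integral_gaussian_wave (horizontal x) (Set.mem_Ioi.1 hu)
        have h2 : ∀ ξ, e ξ * (k ξ u : ℂ) = ((2 * √Real.pi * Real.exp (-t ^ 2 / u ^ 2) : ℝ) : ℂ) *
            (e ξ * (Real.exp (-(Real.pi * ‖ξ‖) ^ 2 * u ^ 2) : ℝ)) := by
          intro ξ
          simp only [hk]
          push_cast
          ring
        simp only [h2]
        rw [integral_const_mul, h1, ← Complex.ofReal_mul]
        congr 1
        rw [norm_sq_eq_horizontal_vertical x, neg_add, add_div, Real.exp_add]
        ring

/-- The Fourier integral is radial in `x`, and the substitution `u = |x| v` extracts `|x|^{1-d}`,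
which is `E` up to a constant. -/
lemma exists_fundSol_eq_integral_poissonWave {d : ℕ} (hd : 2 ≤ d) :
    ∃ c : ℝ, 0 < c ∧ ∀ x : R (d + 1), 0 < vertical x →
      (fundSol (d + 1) x : ℂ) = c * ∫ ξ : R d, ((‖ξ‖⁻¹ : ℝ) : ℂ) * poissonWave x ξ := by
  have : Nonempty (Fin d) := ⟨⟨0, by omega⟩⟩
  have hd2 : (2 : ℝ) ≤ d := by exact_mod_cast hd
  set K : ℝ := ∫ v in Set.Ioi (0 : ℝ), 2 * √Real.pi * ((√Real.pi * v) ^ d)⁻¹ *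
    Real.exp (-1 / v ^ 2) with hK
  have hpos : ∀ x : R (d + 1), 0 < vertical x → 0 < ‖x‖ := fun x hx =>
    hx.trans_le ((le_abs_self _).trans (abs_vertical_le x))
  have hV : ∀ x : R (d + 1), 0 < vertical x →
      ∫ ξ : R d, ((‖ξ‖⁻¹ : ℝ) : ℂ) * poissonWave x ξ = ((K * (‖x‖ * (‖x‖ ^ d)⁻¹) : ℝ) : ℂ) := by
    intro x hx
    have hρ := hpos x hx
    rw [integral_inv_norm_mul_poissonWave hd hx, integral_complex_ofReal]
    congr 1
    have h1 := integral_comp_mul_left_Ioi' (fun u => 2 * √Real.pi * ((√Real.pi * u) ^ d)⁻¹ *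
      Real.exp (-‖x‖ ^ 2 / u ^ 2)) 0 hρ
    rw [mul_zero] at h1
    rw [← h1, hK, smul_eq_mul, ← integral_const_mul, ← integral_mul_const]
    refine setIntegral_congr_fun measurableSet_Ioi fun v hv => ?_
    have hv0 : 0 < v := hv
    have h2 : -‖x‖ ^ 2 / (‖x‖ * v) ^ 2 = -1 / v ^ 2 := by
      field_simp
    simp only [h2]
    rw [mul_left_comm √Real.pi, mul_pow ‖x‖, mul_inv]
    ring
  -- Positivity of `K` is read off at `x = (0, 1)`, where the Fourier integral has a positive
  -- integrable integrand; its value is not computed.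
  have hK0 : 0 < K := by
    have h1 := hV (point 0 1) (by simp)
    have h2 : 0 < ∫ ξ : R d, ‖ξ‖⁻¹ * Real.exp (-(2 * Real.pi) * ‖ξ‖) := by
      rw [integral_pos_iff_support_of_nonneg (fun ξ => by positivity)
        (integrable_inv_norm_mul_exp hd (by positivity))]
      have : Function.support (fun ξ : R d => ‖ξ‖⁻¹ * Real.exp (-(2 * Real.pi) * ‖ξ‖)) = {0}ᶜ := by
        ext ξ; simp [Real.exp_ne_zero]
      rw [this]
      exact isOpen_compl_singleton.measure_pos volume ⟨_, (exists_ne (0 : R d)).choose_spec⟩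
    have h3 : ∫ ξ : R d, ((‖ξ‖⁻¹ : ℝ) : ℂ) * poissonWave (point 0 1) ξ =
        ((∫ ξ : R d, ‖ξ‖⁻¹ * Real.exp (-(2 * Real.pi) * ‖ξ‖) : ℝ) : ℂ) := by
      rw [← integral_complex_ofReal]
      refine integral_congr_ae (Filter.Eventually.of_forall fun ξ => ?_)
      simp [poissonWave]
    rw [h3, Complex.ofReal_inj] at h1
    rw [h1] at h2
    exact pos_of_mul_pos_left h2 (by positivity)
  set D : ℝ := (d + 1 : ℕ) * ((d + 1 : ℕ) - 2) * volume.real (Metric.ball (0 : R (d + 1)) 1) with hD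
  have hD0 : 0 < D := by
    have h1 : 0 < volume.real (Metric.ball (0 : R (d + 1)) 1) :=
      ENNReal.toReal_pos (Metric.measure_ball_pos _ _ one_pos).ne' measure_ball_lt_top.ne
    have h2 : (0 : ℝ) < (d + 1 : ℕ) - 2 := by push_cast; linarith
    positivity
  refine ⟨(D * K)⁻¹, by positivity, fun x hx => ?_⟩
  have hρ := hpos x hx
  rw [hV x hx, ← Complex.ofReal_mul]
  congr 1
  rw [fundSol, ← hD, show (2 - ((d + 1 : ℕ) : ℤ)) = 1 - (d : ℤ) by push_cast; ring,
    zpow_sub₀ hρ.ne', zpow_one, zpow_natCast]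
  field_simp

/-! ### Differentiation of the Fourier representation -/

/-- The symbol of the derivative in direction `v` of `|ξ|⁻¹ e^{2πi⟨ξ, x'⟩ - 2π xₙ |ξ|}`. -/
def waveSymbol {d : ℕ} (v : R (d + 1)) (ξ : R d) : ℂ :=
  ((‖ξ‖⁻¹ : ℝ) : ℂ) * (2 * Real.pi * Complex.I * (inner ℝ ξ (horizontal v) : ℝ) -
    2 * Real.pi * vertical v * ‖ξ‖)

lemma measurable_waveSymbol {d : ℕ} (v : R (d + 1)) : Measurable (waveSymbol v) := by
  unfold waveSymbol
  refine Measurable.mul (by fun_prop) (Continuous.measurable (by fun_prop))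

/-- The tangential derivative contributes the imaginary part of the symbol and the normal derivative
the real part. -/
lemma norm_waveSymbol_sq {d : ℕ} (v : R (d + 1)) {ξ : R d} (hξ : ξ ≠ 0) :
    ‖waveSymbol v ξ‖ ^ 2 =
      4 * Real.pi ^ 2 * ((‖ξ‖ ^ 2)⁻¹ * (inner ℝ ξ (horizontal v)) ^ 2 + vertical v ^ 2) := by
  have hξ0 : ‖ξ‖ ≠ 0 := norm_ne_zero_iff.2 hξ
  have e : waveSymbol v ξ = ((-2 * Real.pi * vertical v : ℝ) : ℂ) +
      ((2 * Real.pi * ‖ξ‖⁻¹ * inner ℝ ξ (horizontal v) : ℝ) : ℂ) * Complex.I := by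
    have : (‖ξ‖ : ℂ) ≠ 0 := by exact_mod_cast hξ0
    rw [waveSymbol]
    push_cast
    field_simp
    ring
  rw [e, ← Complex.normSq_eq_norm_sq, Complex.normSq_add_mul_I]
  field_simp
  ring

lemma norm_waveSymbol_le {d : ℕ} {v : R (d + 1)} (hv : ‖v‖ ≤ 1) {ξ : R d} (hξ : ξ ≠ 0) :
    ‖waveSymbol v ξ‖ ≤ 4 * Real.pi := by
  have hξ0 : 0 < ‖ξ‖ := norm_pos_iff.2 hξ
  refine abs_le_of_sq_le_sq' ?_ (by positivity) |>.2
  rw [norm_waveSymbol_sq v hξ]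
  have h1 : (inner ℝ ξ (horizontal v)) ^ 2 ≤ ‖ξ‖ ^ 2 * 1 := by
    rw [← sq_abs, ← mul_one (1 : ℝ)]
    have := abs_real_inner_le_norm ξ (horizontal v)
    have h2 := (norm_horizontal_le v).trans hv
    calc _ ≤ (‖ξ‖ * ‖horizontal v‖) ^ 2 := by gcongr
      _ = ‖ξ‖ ^ 2 * ‖horizontal v‖ ^ 2 := by ring
      _ ≤ ‖ξ‖ ^ 2 * 1 ^ 2 := by gcongr
      _ = _ := by ring
  have h3 : (‖ξ‖ ^ 2)⁻¹ * (inner ℝ ξ (horizontal v)) ^ 2 ≤ 1 := by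
    rw [inv_mul_le_iff₀ (by positivity)]; exact h1
  have h4 : vertical v ^ 2 ≤ 1 := by
    rw [← sq_abs]
    exact pow_le_one₀ (abs_nonneg _) ((abs_vertical_le v).trans hv)
  nlinarith [sq_nonneg Real.pi]

lemma poissonWave_add_smul {d : ℕ} (x v : R (d + 1)) (s : ℝ) (ξ : R d) :
    poissonWave (x + s • v) ξ = poissonWave x ξ * Complex.exp (s *
      (2 * Real.pi * Complex.I * (inner ℝ ξ (horizontal v) : ℝ) -
        2 * Real.pi * vertical v * ‖ξ‖)) := by
  have h1 : horizontal (x + s • v) = horizontal x + s • horizontal v := by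
    ext i; simp [horizontal]
  have h2 : vertical (x + s • v) = vertical x + s * vertical v := by simp [vertical]
  rw [poissonWave, poissonWave, h1, h2, inner_add_right, inner_smul_right, Complex.ofReal_exp,
    Complex.ofReal_exp, ← Complex.exp_add, ← Complex.exp_add, ← Complex.exp_add]
  congr 1
  push_cast
  ring

lemma hasDerivAt_poissonWave {d : ℕ} (x v : R (d + 1)) (s : ℝ) (ξ : R d) :
    HasDerivAt (fun s : ℝ => ((‖ξ‖⁻¹ : ℝ) : ℂ) * poissonWave (x + s • v) ξ)
      (waveSymbol v ξ * poissonWave (x + s • v) ξ) s := by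
  simp only [poissonWave_add_smul, waveSymbol]
  set m : ℂ := 2 * Real.pi * Complex.I * (inner ℝ ξ (horizontal v) : ℝ) -
    2 * Real.pi * vertical v * ‖ξ‖ with hm
  have h1 : HasDerivAt (fun s : ℝ => Complex.exp (s * m)) (Complex.exp (s * m) * (1 * m)) s :=
    ((hasDerivAt_id s).ofReal_comp.mul_const m).cexp
  refine ((h1.const_mul (poissonWave x ξ)).const_mul ((‖ξ‖⁻¹ : ℝ) : ℂ)).congr_deriv ?_
  ring

lemma hasDerivAt_integral_poissonWave {d : ℕ} (hd : 2 ≤ d) {x v : R (d + 1)}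
    (hx : 0 < vertical x) (hv : ‖v‖ ≤ 1) :
    HasDerivAt (fun s : ℝ => ∫ ξ : R d, ((‖ξ‖⁻¹ : ℝ) : ℂ) * poissonWave (x + s • v) ξ)
      (∫ ξ : R d, waveSymbol v ξ * poissonWave x ξ) 0 := by
  have : Nonempty (Fin d) := ⟨⟨0, by omega⟩⟩
  have hne : ∀ᵐ ξ : R d, ξ ≠ 0 := Measure.ae_ne volume 0
  have hpm : ∀ s : ℝ, Measurable fun ξ => poissonWave (x + s • v) ξ := fun s =>
    (continuous_poissonWave.comp (by fun_prop : Continuous fun ξ : R d => (x + s • v, ξ))).measurable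
  have hF : ∀ s : ℝ, Measurable fun ξ => ((‖ξ‖⁻¹ : ℝ) : ℂ) * poissonWave (x + s • v) ξ := fun s =>
    Measurable.mul (by fun_prop) (hpm s)
  -- For `|s| < xₙ/2` and `|v| ≤ 1` the height stays above `xₙ/2`, so `4π e^{-π xₙ|ξ|}` dominates
  -- the derivatives.
  have key := hasDerivAt_integral_of_dominated_loc_of_deriv_le (μ := volume) (x₀ := (0 : ℝ))
    (F := fun (s : ℝ) (ξ : R d) => ((‖ξ‖⁻¹ : ℝ) : ℂ) * poissonWave (x + s • v) ξ)
    (F' := fun (s : ℝ) (ξ : R d) => waveSymbol v ξ * poissonWave (x + s • v) ξ)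
    (s := Metric.ball 0 (vertical x / 2))
    (bound := fun ξ => 4 * Real.pi * Real.exp (-(Real.pi * vertical x) * ‖ξ‖))
    (Metric.ball_mem_nhds 0 (by positivity))
    (Filter.Eventually.of_forall fun s => (hF s).aestronglyMeasurable) ?_
    ((measurable_waveSymbol v).mul (hpm 0)).aestronglyMeasurable ?_ ?_ ?_
  · simpa only [zero_smul, add_zero] using key.2
  · refine (integrable_inv_norm_mul_exp hd (by positivity : 0 < 2 * Real.pi * vertical x)).mono'
      (hF 0).aestronglyMeasurable (Filter.Eventually.of_forall fun ξ => ?_)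
    rw [norm_mul, norm_poissonWave, Complex.norm_real, Real.norm_of_nonneg (by positivity),
      zero_smul, add_zero]
  · filter_upwards [hne] with ξ hξ s hs
    rw [norm_mul, norm_poissonWave]
    have h1 := norm_waveSymbol_le hv hξ
    have h2 : vertical x / 2 ≤ vertical (x + s • v) := by
      have e : vertical (x + s • v) = vertical x + s * vertical v := by simp [vertical]
      have h3 : |s * vertical v| ≤ vertical x / 2 := by
        rw [abs_mul]
        have h4 : |s| < vertical x / 2 := by simpa using hs
        have h5 := (abs_vertical_le v).trans hv
        nlinarith [abs_nonneg s, abs_nonneg (vertical v)]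
      rw [e]; linarith [neg_abs_le (s * vertical v)]
    refine mul_le_mul h1 (Real.exp_le_exp.2 ?_) (Real.exp_nonneg _) (by positivity)
    have := mul_le_mul_of_nonneg_left h2 (by positivity : 0 ≤ 2 * Real.pi * ‖ξ‖)
    linarith
  · have := (integrable_norm_rpow_mul_exp (d := d) (by omega) (s := 0) (c := Real.pi * vertical x)
      (by simpa using (by omega : 0 < d)) (by positivity)).const_mul (4 * Real.pi)
    simpa only [Real.rpow_zero, one_mul] using this
  · exact Filter.Eventually.of_forall fun ξ s _ => hasDerivAt_poissonWave x v s ξ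

/-- The gradient of the fundamental solution as a Fourier integral. -/
lemma exists_gradKernel_eq_integral {d : ℕ} (hd : 2 ≤ d) :
    ∃ c : ℝ, 0 < c ∧ ∀ x : R (d + 1), 0 < vertical x → ∀ (j : Fin (d + 1)) (y : R d),
      gradKernel x j (point y 0) =
        c * ∫ ξ : R d, waveSymbol (EuclideanSpace.single j 1) ξ * poissonWave (x - point y 0) ξ := by
  obtain ⟨c, hc, H⟩ := exists_fundSol_eq_integral_poissonWave hd
  refine ⟨c, hc, fun x hx j y => ?_⟩
  set z := x - point y 0 with hz
  have hz0 : 0 < vertical z := by rw [hz, vertical_sub, vertical_point, sub_zero]; exact hx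
  have hzne : z ≠ 0 := by
    rintro h
    rw [h] at hz0
    simp [vertical] at hz0
  set v : R (d + 1) := EuclideanSpace.single j 1 with hv
  have hv1 : ‖v‖ ≤ 1 := by simp [hv]
  have h1 : HasDerivAt (fun s : ℝ => fundSol (d + 1) (z + s • v)) (gradient (fundSol (d + 1)) z j)
      0 := by
    have hg := (hasGradientAt_fundSol (by omega : 3 ≤ d + 1) hzne).differentiableAt.hasGradientAt.hasFDerivAt
    have hl : HasDerivAt (fun s : ℝ => z + s • v) v 0 := by
      simpa using ((hasDerivAt_id (0 : ℝ)).smul_const v).const_add z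
    have hg' : HasFDerivAt (fundSol (d + 1))
        (InnerProductSpace.toDual ℝ (R (d + 1)) (gradient (fundSol (d + 1)) z)) (z + (0 : ℝ) • v) := by
      simpa using hg
    refine (hg'.comp_hasDerivAt 0 hl).congr_deriv ?_
    rw [InnerProductSpace.toDual_apply_apply, hv, EuclideanSpace.inner_single_right]
    simp
  have h2 := (hasDerivAt_integral_poissonWave hd hz0 hv1).const_mul (c : ℂ)
  -- The representation is available only at positive height, a condition that persists for small
  -- `s`; this suffices to compare derivatives at `0`.
  have h3 : (fun s : ℝ => ((fundSol (d + 1) (z + s • v) : ℝ) : ℂ)) =ᶠ[nhds 0]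
      fun s : ℝ => c * ∫ ξ : R d, ((‖ξ‖⁻¹ : ℝ) : ℂ) * poissonWave (z + s • v) ξ := by
    have hcont : Continuous fun s : ℝ => vertical (z + s • v) :=
      continuous_vertical.comp (by fun_prop)
    have : ∀ᶠ s : ℝ in nhds 0, 0 < vertical (z + s • v) :=
      hcont.continuousAt.eventually_const_lt (by simpa using hz0)
    filter_upwards [this] with s hs
    exact H _ hs
  exact h1.ofReal_comp.unique (h2.congr_of_eventuallyEq h3)

/-! ### The Fourier transform on `L¹ ∩ L²` -/

lemma integral_fourier_mul_eq_of_integrable {d : ℕ} {f g : R d → ℂ} (hf : Integrable f)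
    (hg : Integrable g) : ∫ ξ, 𝓕 f ξ * g ξ = ∫ x, f x * 𝓕 g x := by
  have := VectorFourier.integral_fourierIntegral_smul_eq_flip (L := innerₗ (R d))
    Real.continuous_fourierChar continuous_inner hf hg
  rwa [flip_innerₗ] at this

/-- Both sides give the same integrals against smooth compactly supported functions: for each of
them the Fourier transform can be moved onto the test function. -/
lemma fourier_toLp_ae_eq {d : ℕ} {f : R d → ℂ} (h1 : Integrable f) (h2 : MemLp f 2) :
    ((𝓕 (h2.toLp f) : Lp ℂ 2 (volume : Measure (R d))) : R d → ℂ) =ᵐ[volume] 𝓕 f := by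
  have hcont : Continuous (𝓕 f) :=
    VectorFourier.fourierIntegral_continuous Real.continuous_fourierChar continuous_inner h1
  refine ae_eq_of_integral_contDiff_smul_eq
    ((Lp.memLp _).locallyIntegrable (by norm_num)) hcont.locallyIntegrable fun g hg hgc => ?_
  have hg1 : HasCompactSupport (Complex.ofRealCLM ∘ g) := hgc.comp_left rfl
  have hg2 : ContDiff ℝ ((⊤ : ℕ∞) : WithTop ℕ∞) (Complex.ofRealCLM ∘ g) := by fun_prop
  set φ : 𝓢(R d, ℂ) := hg1.toSchwartzMap hg2 with hφ
  have hφg : ∀ x, φ x = (g x : ℂ) := fun x => rfl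
  have e1 : ∫ x, g x • ((𝓕 (h2.toLp f) : Lp ℂ 2 (volume : Measure (R d))) : R d → ℂ) x =
      Lp.toTemperedDistribution (𝓕 (h2.toLp f) : Lp ℂ 2 (volume : Measure (R d))) φ := by
    rw [Lp.toTemperedDistribution_apply]
    rfl
  have e2 : ∫ x, g x • 𝓕 f x = ∫ x, 𝓕 f x * φ x := by
    refine integral_congr_ae (Filter.Eventually.of_forall fun x => ?_)
    simp only [hφg]
    rw [Complex.real_smul, mul_comm]
  rw [e1, e2, integral_fourier_mul_eq_of_integrable h1 φ.integrable,
    ← Lp.fourier_toTemperedDistribution_eq, TemperedDistribution.fourier_apply,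
    Lp.toTemperedDistribution_apply]
  refine integral_congr_ae ?_
  filter_upwards [h2.coeFn_toLp] with x hx
  rw [hx, smul_eq_mul, mul_comm, SchwartzMap.fourier_coe]

lemma memLp_fourier {d : ℕ} {f : R d → ℂ} (h1 : Integrable f) (h2 : MemLp f 2) : MemLp (𝓕 f) 2 :=
  (memLp_congr_ae (fourier_toLp_ae_eq h1 h2)).1 (Lp.memLp _)

lemma eLpNorm_fourier {d : ℕ} {f : R d → ℂ} (h1 : Integrable f) (h2 : MemLp f 2) :
    eLpNorm (𝓕 f) 2 = eLpNorm f 2 := by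
  rw [← eLpNorm_congr_ae (fourier_toLp_ae_eq h1 h2), ← eLpNorm_congr_ae h2.coeFn_toLp,
    ← ENNReal.ofReal_toReal (Lp.eLpNorm_ne_top _), ← Lp.norm_def, Lp.norm_fourier_eq, Lp.norm_def,
    ENNReal.ofReal_toReal (Lp.eLpNorm_ne_top _)]

lemma eLpNorm_fourierInv {d : ℕ} {f : R d → ℂ} (h1 : Integrable f) (h2 : MemLp f 2) :
    eLpNorm (𝓕⁻ f) 2 = eLpNorm f 2 := by
  have e : (𝓕⁻ f : R d → ℂ) = 𝓕 f ∘ Neg.neg := funext fun x => Real.fourierInv_eq_fourier_neg f x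
  rw [e, eLpNorm_comp_measurePreserving (memLp_fourier h1 h2).1 (Measure.measurePreserving_neg _),
    eLpNorm_fourier h1 h2]

/-- Fourier inversion is done in `L²`, because `k` is not assumed integrable. In the application `k`
is the trace of `∂ⱼE(x - ·)` on the boundary plane. -/
lemma fourierInv_toLp_fourier_ae_eq {d : ℕ} {f k : R d → ℂ} (h1 : Integrable f) (h2 : MemLp f 2)
    (hk : MemLp k 2) (hkf : k = 𝓕 f) :
    ((𝓕⁻ (hk.toLp k) : Lp ℂ 2 (volume : Measure (R d))) : R d → ℂ) =ᵐ[volume] f := by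
  have e : hk.toLp k = (𝓕 (h2.toLp f) : Lp ℂ 2 (volume : Measure (R d))) := by
    refine Lp.ext (hk.coeFn_toLp.trans ?_)
    rw [hkf]
    exact (fourier_toLp_ae_eq h1 h2).symm
  rw [e, fourierInv_fourier_eq]
  exact h2.coeFn_toLp

/-! ### The flat half space -/

lemma poissonWave_eq {d : ℕ} (x : R (d + 1)) (ξ : R d) :
    poissonWave x ξ = Complex.exp (2 * Real.pi * Complex.I * (inner ℝ ξ (horizontal x) : ℝ)) *
      (Real.exp (-(2 * Real.pi * vertical x) * ‖ξ‖) : ℝ) := rfl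

lemma poissonWave_sub_point {d : ℕ} (x : R (d + 1)) (y ξ : R d) :
    poissonWave (x - point y 0) ξ =
      Complex.exp (((-2 * Real.pi * inner ℝ ξ y : ℝ) : ℂ) * Complex.I) * poissonWave x ξ := by
  rw [poissonWave_eq, poissonWave_eq, horizontal_sub, vertical_sub, horizontal_point,
    vertical_point, sub_zero, ← mul_assoc, ← Complex.exp_add, inner_sub_right]
  congr 2
  push_cast
  ring

lemma ae_norm_waveSymbol_le {d : ℕ} (hd : 0 < d) (j : Fin (d + 1)) :
    ∀ᵐ ξ : R d, ‖waveSymbol (EuclideanSpace.single j (1 : ℝ)) ξ‖ ≤ 4 * Real.pi := by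
  have : Nonempty (Fin d) := ⟨⟨0, hd⟩⟩
  filter_upwards [Measure.ae_ne volume (0 : R d)] with ξ hξ
  exact norm_waveSymbol_le (by simp) hξ

/-- The tangential symbols add up to `4π²|ξ|²/|ξ|²` and the normal one contributes another `4π²`;
independence of `ξ` turns the final estimate into an identity. -/
lemma sum_norm_waveSymbol_sq {d : ℕ} {ξ : R d} (hξ : ξ ≠ 0) :
    ∑ j : Fin (d + 1), ‖waveSymbol (EuclideanSpace.single j (1 : ℝ)) ξ‖ ^ 2 =
      8 * Real.pi ^ 2 := by
  have hξ0 : ‖ξ‖ ≠ 0 := norm_ne_zero_iff.2 hξ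
  have h1 : ∀ i : Fin d, horizontal (EuclideanSpace.single i.castSucc (1 : ℝ)) =
      EuclideanSpace.single i 1 := by
    intro i; ext k; simp [horizontal]
  have h2 : ∀ i : Fin d, vertical (EuclideanSpace.single i.castSucc (1 : ℝ)) = 0 := by
    intro i; simp [vertical, (Fin.castSucc_lt_last i).ne']
  have h3 : horizontal (EuclideanSpace.single (Fin.last d) (1 : ℝ)) = 0 := by
    ext k; simp [horizontal]
  have h4 : vertical (EuclideanSpace.single (Fin.last d) (1 : ℝ)) = 1 := by simp [vertical]
  simp only [norm_waveSymbol_sq _ hξ]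
  rw [Fin.sum_univ_castSucc]
  simp only [h1, h2, h3, h4, EuclideanSpace.inner_single_right, inner_zero_right]
  rw [← Finset.mul_sum, Finset.sum_add_distrib, ← Finset.mul_sum]
  have h5 : ∑ i : Fin d, (1 * (starRingEnd ℝ) (ξ i)) ^ 2 = ‖ξ‖ ^ 2 := by
    simp [EuclideanSpace.norm_sq_eq]
  rw [h5, inv_mul_cancel₀ (by positivity)]
  simp
  ring

lemma integrable_exp_neg_norm {d : ℕ} (hd : 0 < d) {c : ℝ} (hc : 0 < c) :
    Integrable fun ξ : R d => Real.exp (-c * ‖ξ‖) := by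
  simpa only [Real.rpow_zero, one_mul] using
    integrable_norm_rpow_mul_exp hd (s := 0) (by simpa using hd) hc

lemma memLp_exp_neg_norm {d : ℕ} (hd : 0 < d) {c : ℝ} (hc : 0 < c) :
    MemLp (fun ξ : R d => Real.exp (-c * ‖ξ‖)) 2 := by
  rw [memLp_two_iff_integrable_sq (by fun_prop)]
  refine (integrable_exp_neg_norm hd (by positivity : 0 < 2 * c)).congr
    (Filter.Eventually.of_forall fun ξ => ?_)
  simp only
  rw [← Real.exp_nat_mul]
  congr 1; push_cast; ring

lemma integrable_and_memLp_waveSymbol_mul_poissonWave {d : ℕ} (hd : 0 < d) (c : ℂ)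
    {x : R (d + 1)} (hx : 0 < vertical x) (j : Fin (d + 1)) :
    Integrable (fun ξ : R d => c *
        (waveSymbol (EuclideanSpace.single j (1 : ℝ)) ξ * poissonWave x ξ)) ∧
      MemLp (fun ξ : R d => c *
        (waveSymbol (EuclideanSpace.single j (1 : ℝ)) ξ * poissonWave x ξ)) 2 := by
  have hm : Measurable fun ξ : R d => c *
      (waveSymbol (EuclideanSpace.single j (1 : ℝ)) ξ * poissonWave x ξ) :=
    ((measurable_waveSymbol _).mul (continuous_poissonWave.comp
      (by fun_prop : Continuous fun ξ : R d => (x, ξ))).measurable).const_mul c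
  have hb : ∀ᵐ ξ : R d, ‖c * (waveSymbol (EuclideanSpace.single j (1 : ℝ)) ξ * poissonWave x ξ)‖ ≤
      ‖c‖ * (4 * Real.pi) * ‖Real.exp (-(2 * Real.pi * vertical x) * ‖ξ‖)‖ := by
    filter_upwards [ae_norm_waveSymbol_le hd j] with ξ hξ
    rw [norm_mul, norm_mul, norm_poissonWave, Real.norm_of_nonneg (Real.exp_nonneg _), ← mul_assoc]
    gcongr
  have hc : 0 < 2 * Real.pi * vertical x := by positivity
  refine ⟨?_, (memLp_exp_neg_norm hd hc).of_le_mul hm.aestronglyMeasurable hb⟩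
  exact memLp_one_iff_integrable.1 ((memLp_one_iff_integrable.2
    (integrable_exp_neg_norm hd hc)).of_le_mul hm.aestronglyMeasurable hb)

lemma gradKernel_point_eq_fourier {d : ℕ} {c : ℝ} {x : R (d + 1)} {j : Fin (d + 1)}
    (h : ∀ y : R d, gradKernel x j (point y 0) =
      c * ∫ ξ : R d, waveSymbol (EuclideanSpace.single j 1) ξ * poissonWave (x - point y 0) ξ) :
    (fun y : R d => gradKernel x j (point y 0)) =
      𝓕 fun ξ : R d => (c : ℂ) *
        (waveSymbol (EuclideanSpace.single j (1 : ℝ)) ξ * poissonWave x ξ) := by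
  ext y
  rw [h, Real.fourier_eq', ← integral_const_mul]
  refine integral_congr_ae (Filter.Eventually.of_forall fun ξ => ?_)
  simp only [poissonWave_sub_point, smul_eq_mul]
  ring

/-- Exponentially damped, the Fourier transform of an element of `Ḣ^{-1/2}` is in `L¹ ∩ L²`. -/
lemma HomSobolev.integrable_and_memLp_damped {d : ℕ} (hd : 0 < d) (g : HomSobolev d (-(1 / 2)))
    {c : ℝ} (hc : 0 < c) :
    Integrable (fun ξ : R d => (Real.exp (-c * ‖ξ‖) : ℂ) * g.fourier ξ) ∧
      MemLp (fun ξ : R d => (Real.exp (-c * ‖ξ‖) : ℂ) * g.fourier ξ) 2 := by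
  have : Nonempty (Fin d) := ⟨⟨0, hd⟩⟩
  have hu := g.memLp_two
  -- The damped transform is `a u` with `u ∈ L²` and `a = |ξ|^{1/2} e^{-c|ξ|}`. Since `a` is in
  -- `L²`, the product is in `L¹`; since `a` is bounded, the product is in `L²`.
  set u : R d → ℂ := fun ξ => ((‖ξ‖ ^ (-(1 / 2) : ℝ) : ℝ) : ℂ) * g.fourier ξ with hudef
  set a : R d → ℂ := fun ξ => ((‖ξ‖ ^ (1 / 2 : ℝ) * Real.exp (-c * ‖ξ‖) : ℝ) : ℂ) with ha
  have ham : Measurable a := Complex.measurable_ofReal.comp (by fun_prop)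
  have e : (fun ξ : R d => (Real.exp (-c * ‖ξ‖) : ℂ) * g.fourier ξ) =ᵐ[volume]
      fun ξ => a ξ * u ξ := by
    filter_upwards [Measure.ae_ne volume (0 : R d)] with ξ hξ
    have hξ0 : 0 < ‖ξ‖ := norm_pos_iff.2 hξ
    have h1 : ‖ξ‖ ^ (1 / 2 : ℝ) * ‖ξ‖ ^ (-(1 / 2) : ℝ) = 1 := by
      rw [← Real.rpow_add hξ0]; norm_num
    simp only [ha, hudef]
    rw [show ((‖ξ‖ ^ (1 / 2 : ℝ) * Real.exp (-c * ‖ξ‖) : ℝ) : ℂ) *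
      (((‖ξ‖ ^ (-(1 / 2) : ℝ) : ℝ) : ℂ) * g.fourier ξ) =
      ((‖ξ‖ ^ (1 / 2 : ℝ) * ‖ξ‖ ^ (-(1 / 2) : ℝ) : ℝ) : ℂ) *
        ((Real.exp (-c * ‖ξ‖) : ℝ) * g.fourier ξ) by push_cast; ring, h1]
    push_cast
    ring
  have hanorm : ∀ ξ, ‖a ξ‖ = ‖ξ‖ ^ (1 / 2 : ℝ) * Real.exp (-c * ‖ξ‖) := fun ξ => by
    rw [ha, Complex.norm_real, Real.norm_of_nonneg (by positivity)]
  have ha2 : MemLp a 2 := by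
    rw [memLp_two_iff_integrable_sq_norm ham.aestronglyMeasurable]
    refine (integrable_norm_rpow_mul_exp hd (s := 1) (c := 2 * c)
      (by linarith [(Nat.cast_nonneg d : (0 : ℝ) ≤ d)]) (by positivity)).congr
      (Filter.Eventually.of_forall fun ξ => ?_)
    simp only [hanorm]
    rw [mul_pow, ← Real.exp_nat_mul, ← Real.rpow_natCast (‖ξ‖ ^ (1 / 2 : ℝ)),
      ← Real.rpow_mul (norm_nonneg _)]
    congr 1
    · norm_num
    · congr 1; push_cast; ring
  have hab : ∀ ξ, ‖a ξ‖ ≤ 1 + c⁻¹ := by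
    intro ξ
    have h1 : ‖ξ‖ ^ (1 / 2 : ℝ) ≤ 1 + ‖ξ‖ := by
      rw [← Real.sqrt_eq_rpow]
      refine Real.sqrt_le_iff.2 ⟨by positivity, ?_⟩
      nlinarith [norm_nonneg ξ]
    have h2 : 1 + c * ‖ξ‖ ≤ Real.exp (c * ‖ξ‖) := by linarith [Real.add_one_le_exp (c * ‖ξ‖)]
    have h3 : 1 + ‖ξ‖ ≤ (1 + c⁻¹) * (1 + c * ‖ξ‖) := by
      have : c⁻¹ * c = 1 := inv_mul_cancel₀ hc.ne'
      have h4 : 0 < c⁻¹ := by positivity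
      have h5 : 0 ≤ c * ‖ξ‖ := by positivity
      calc 1 + ‖ξ‖ = 1 + c⁻¹ * c * ‖ξ‖ := by rw [this, one_mul]
        _ ≤ 1 + c⁻¹ * c * ‖ξ‖ + (c⁻¹ + c * ‖ξ‖) := le_add_of_nonneg_right (by positivity)
        _ = _ := by ring
    rw [hanorm, neg_mul, Real.exp_neg, ← div_eq_mul_inv, div_le_iff₀ (Real.exp_pos _)]
    exact h1.trans (h3.trans (by gcongr))
  refine ⟨(ha2.integrable_mul hu).congr e.symm, (memLp_congr_ae e).2 ?_⟩
  refine hu.of_le_mul (c := 1 + c⁻¹) (ham.aestronglyMeasurable.mul hu.1)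
    (Filter.Eventually.of_forall fun ξ => ?_)
  rw [norm_mul]
  exact mul_le_mul_of_nonneg_right (hab ξ) (norm_nonneg _)

lemma HomSobolev.integrable_and_memLp_symbol {d : ℕ} (hd : 0 < d) (g : HomSobolev d (-(1 / 2)))
    (c : ℂ) {t : ℝ} (ht : 0 < t) (j : Fin (d + 1)) :
    Integrable (fun ξ : R d => c * waveSymbol (EuclideanSpace.single j (1 : ℝ)) ξ *
        ((Real.exp (-(2 * Real.pi * t) * ‖ξ‖) : ℂ) * g.fourier ξ)) ∧
      MemLp (fun ξ : R d => c * waveSymbol (EuclideanSpace.single j (1 : ℝ)) ξ *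
        ((Real.exp (-(2 * Real.pi * t) * ‖ξ‖) : ℂ) * g.fourier ξ)) 2 := by
  obtain ⟨h1, h2⟩ := g.integrable_and_memLp_damped hd (by positivity : 0 < 2 * Real.pi * t)
  have hm : AEStronglyMeasurable (fun ξ : R d =>
      c * waveSymbol (EuclideanSpace.single j (1 : ℝ)) ξ *
        ((Real.exp (-(2 * Real.pi * t) * ‖ξ‖) : ℂ) * g.fourier ξ)) volume :=
    ((measurable_waveSymbol _).const_mul c).aestronglyMeasurable.mul h1.1
  have hb : ∀ᵐ ξ : R d, ‖c * waveSymbol (EuclideanSpace.single j (1 : ℝ)) ξ *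
        ((Real.exp (-(2 * Real.pi * t) * ‖ξ‖) : ℂ) * g.fourier ξ)‖ ≤
      ‖c‖ * (4 * Real.pi) * ‖(Real.exp (-(2 * Real.pi * t) * ‖ξ‖) : ℂ) * g.fourier ξ‖ := by
    filter_upwards [ae_norm_waveSymbol_le hd j] with ξ hξ
    rw [norm_mul, norm_mul c]
    gcongr
  exact ⟨memLp_one_iff_integrable.1 ((memLp_one_iff_integrable.2 h1).of_le_mul hm hb),
    h2.of_le_mul hm hb⟩

/-- The pairing with the kernel, written on the Fourier side. -/
lemma exists_pairIntegrand_ae_eq {d : ℕ} (hd : 2 ≤ d) :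
    ∃ c : ℝ, 0 < c ∧ ∀ x : R (d + 1), 0 < vertical x → ∀ j : Fin (d + 1),
      ∃ hk : MemLp (fun y : R d => gradKernel x j (point y 0)) 2 volume,
        ∀ g : HomSobolev d (-(1 / 2)), g.pairIntegrand hk =ᵐ[volume] fun ξ =>
          g.fourier ξ * ((c : ℂ) *
            (waveSymbol (EuclideanSpace.single j (1 : ℝ)) ξ * poissonWave x ξ)) := by
  obtain ⟨c, hc, H⟩ := exists_gradKernel_eq_integral hd
  refine ⟨c, hc, fun x hx j => ?_⟩
  obtain ⟨h1, h2⟩ := integrable_and_memLp_waveSymbol_mul_poissonWave (by omega) (c : ℂ) hx j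
  have e := gradKernel_point_eq_fourier (H x hx j)
  have hk : MemLp (fun y : R d => gradKernel x j (point y 0)) 2 volume := by
    rw [e]; exact memLp_fourier h1 h2
  refine ⟨hk, fun g => ?_⟩
  filter_upwards [fourierInv_toLp_fourier_ae_eq h1 h2 hk e] with ξ hξ
  rw [HomSobolev.pairIntegrand, hξ]

lemma lintegral_halfSpace {d : ℕ} {f : R (d + 1) → ℝ≥0∞} (hf : Measurable f) :
    ∫⁻ x in halfSpace d, f x = ∫⁻ t in Set.Ioi (0 : ℝ), ∫⁻ y : R d, f (point y t) := by
  have hH : MeasurableSet (halfSpace d) :=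
    (isOpen_lt continuous_const continuous_vertical).measurableSet
  have hm : Measurable ((halfSpace d).indicator f) := hf.indicator hH
  rw [← lintegral_indicator hH, lintegral_eq_lintegral_point hm, lintegral_lintegral_swap
    (f := fun (y : R d) (t : ℝ) => (halfSpace d).indicator f (point y t)) (hm.comp continuous_point.measurable).aemeasurable, ← lintegral_indicator measurableSet_Ioi]
  refine lintegral_congr fun t => ?_
  by_cases ht : 0 < t
  · rw [Set.indicator_of_mem (Set.mem_Ioi.2 ht)]
    refine lintegral_congr fun y => Set.indicator_of_mem ?_ _
    simpa [halfSpace] using ht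
  · rw [Set.indicator_of_notMem (by simpa using ht)]
    refine (lintegral_congr fun y => Set.indicator_of_notMem ?_ _).trans lintegral_zero
    simpa [halfSpace] using ht

lemma lintegral_Ioi_exp_neg_mul {c : ℝ} (hc : 0 < c) :
    ∫⁻ t in Set.Ioi (0 : ℝ), ENNReal.ofReal (Real.exp (-c * t)) = ENNReal.ofReal c⁻¹ := by
  rw [← ofReal_integral_eq_lintegral_ofReal (integrableOn_exp_mul_Ioi (neg_lt_zero.2 hc) 0)
    (Filter.Eventually.of_forall fun t => Real.exp_nonneg _), integral_exp_mul_Ioi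
    (neg_lt_zero.2 hc)]
  congr 1
  simp [neg_div_neg_eq]

lemma HomSobolev.lintegral_symbol {d : ℕ} (hd : 0 < d) (g : HomSobolev d (-(1 / 2))) {c : ℝ}
    (hc : 0 < c) :
    ∫⁻ t in Set.Ioi (0 : ℝ), ∑ j : Fin (d + 1), ∫⁻ ξ : R d,
      ‖(c : ℂ) * waveSymbol (EuclideanSpace.single j (1 : ℝ)) ξ *
        ((Real.exp (-(2 * Real.pi * t) * ‖ξ‖) : ℂ) * g.fourier ξ)‖ₑ ^ 2 =
      ENNReal.ofReal (c * √(2 * Real.pi) * g.norm) ^ 2 := by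
  have : Nonempty (Fin d) := ⟨⟨0, hd⟩⟩
  have hne : ∀ᵐ ξ : R d, ξ ≠ 0 := Measure.ae_ne volume 0
  have hgm : AEMeasurable (fun ξ => ‖g.fourier ξ‖ₑ ^ 2) volume :=
    g.locallyIntegrable.aestronglyMeasurable.enorm.pow_const 2
  have hm2 : Measurable fun p : ℝ × R d =>
      ENNReal.ofReal (8 * Real.pi ^ 2 * c ^ 2 * Real.exp (-(4 * Real.pi * p.1) * ‖p.2‖)) := by
    fun_prop
  have e1 : ∀ t ∈ Set.Ioi (0 : ℝ), ∑ j : Fin (d + 1), ∫⁻ ξ : R d,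
      ‖(c : ℂ) * waveSymbol (EuclideanSpace.single j (1 : ℝ)) ξ *
        ((Real.exp (-(2 * Real.pi * t) * ‖ξ‖) : ℂ) * g.fourier ξ)‖ₑ ^ 2 =
      ∫⁻ ξ : R d, ‖g.fourier ξ‖ₑ ^ 2 *
        ENNReal.ofReal (8 * Real.pi ^ 2 * c ^ 2 * Real.exp (-(4 * Real.pi * t) * ‖ξ‖)) := by
    intro t ht
    rw [← lintegral_finsetSum' _ fun j _ =>
      ((g.integrable_and_memLp_symbol hd (c : ℂ) ht j).1.1.enorm.pow_const 2)]
    refine lintegral_congr_ae ?_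
    filter_upwards [hne] with ξ hξ
    have h1 : ∀ j : Fin (d + 1), ‖(c : ℂ) * waveSymbol (EuclideanSpace.single j (1 : ℝ)) ξ *
        ((Real.exp (-(2 * Real.pi * t) * ‖ξ‖) : ℂ) * g.fourier ξ)‖ₑ ^ 2 =
        ENNReal.ofReal (‖waveSymbol (EuclideanSpace.single j (1 : ℝ)) ξ‖ ^ 2 *
          (c ^ 2 * Real.exp (-(4 * Real.pi * t) * ‖ξ‖) * ‖g.fourier ξ‖ ^ 2)) := by
      intro j
      rw [← ofReal_norm, ← ENNReal.ofReal_pow (norm_nonneg _)]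
      congr 1
      rw [norm_mul, norm_mul, norm_mul, Complex.norm_real, Complex.norm_real,
        Real.norm_of_nonneg hc.le, Real.norm_of_nonneg (Real.exp_nonneg _), mul_pow, mul_pow,
        mul_pow, ← Real.exp_nat_mul]
      rw [show ((2 : ℕ) : ℝ) * (-(2 * Real.pi * t) * ‖ξ‖) = -(4 * Real.pi * t) * ‖ξ‖ by
        push_cast; ring]
      ring
    simp only [h1]
    rw [← ENNReal.ofReal_sum_of_nonneg fun j _ => by positivity, ← Finset.sum_mul,
      sum_norm_waveSymbol_sq hξ, ← ofReal_norm, ← ENNReal.ofReal_pow (norm_nonneg _),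
      ← ENNReal.ofReal_mul (by positivity)]
    congr 1
    ring
  have hm3 : AEMeasurable (Function.uncurry fun (t : ℝ) (ξ : R d) => ‖g.fourier ξ‖ₑ ^ 2 *
      ENNReal.ofReal (8 * Real.pi ^ 2 * c ^ 2 * Real.exp (-(4 * Real.pi * t) * ‖ξ‖)))
      ((volume.restrict (Set.Ioi 0)).prod volume) :=
    hgm.comp_snd.mul hm2.aemeasurable
  rw [setLIntegral_congr_fun measurableSet_Ioi e1, lintegral_lintegral_swap hm3]
  -- Integration over the height replaces `8π² c²` by `8π² c² / (4π|ξ|) = 2π c² |ξ|⁻¹`, which is the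
  -- weight of `Ḣ^{-1/2}`.
  have e2 : ∀ᵐ ξ : R d, ∫⁻ t in Set.Ioi (0 : ℝ), ‖g.fourier ξ‖ₑ ^ 2 *
        ENNReal.ofReal (8 * Real.pi ^ 2 * c ^ 2 * Real.exp (-(4 * Real.pi * t) * ‖ξ‖)) =
      ENNReal.ofReal (c ^ 2 * (2 * Real.pi)) *
        ‖((‖ξ‖ ^ (-(1 / 2) : ℝ) : ℝ) : ℂ) * g.fourier ξ‖ₑ ^ 2 := by
    filter_upwards [hne] with ξ hξ
    have hξ0 : 0 < ‖ξ‖ := norm_pos_iff.2 hξ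
    have h1 : ∀ t : ℝ, -(4 * Real.pi * t) * ‖ξ‖ = -(4 * Real.pi * ‖ξ‖) * t := fun t => by ring
    simp only [h1, ENNReal.ofReal_mul (by positivity : 0 ≤ 8 * Real.pi ^ 2 * c ^ 2)]
    rw [lintegral_const_mul _ (by fun_prop), lintegral_const_mul _ (by fun_prop),
      lintegral_Ioi_exp_neg_mul (by positivity), ← ofReal_norm, ← ofReal_norm,
      ← ENNReal.ofReal_pow (norm_nonneg _), ← ENNReal.ofReal_pow (norm_nonneg _),
      ← ENNReal.ofReal_mul (by positivity), ← ENNReal.ofReal_mul (by positivity),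
      ← ENNReal.ofReal_mul (by positivity), norm_mul, Complex.norm_real,
      Real.norm_of_nonneg (by positivity), mul_pow, ← Real.rpow_natCast (‖ξ‖ ^ _),
      ← Real.rpow_mul hξ0.le]
    congr 1
    rw [show (-(1 / 2) : ℝ) * ((2 : ℕ) : ℝ) = -1 by norm_num, Real.rpow_neg_one]
    have := Real.pi_pos
    field_simp
    ring
  rw [lintegral_congr_ae e2, lintegral_const_mul' _ _ ENNReal.ofReal_ne_top, ← eLpNorm_two_sq,
    HomSobolev.norm, ENNReal.ofReal_mul (by positivity : 0 ≤ c * √(2 * Real.pi)), mul_pow,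
    ENNReal.ofReal_toReal g.memLp_two.2.ne, ← ENNReal.ofReal_pow (by positivity), mul_pow,
    Real.sq_sqrt (by positivity)]

/-- On each horizontal slice the components of the potential are inverse Fourier transforms of
functions in `L¹ ∩ L²`, so Plancherel slice by slice followed by Tonelli gives the norm exactly. -/
theorem halfSpace_identity {d : ℕ} (hd : 2 ≤ d) :
    ∃ C : ℝ, 0 < C ∧
      ∀ g : HomSobolev d (-(1 / 2)),
        (∀ x ∈ halfSpace d, ∀ j,
          ∃ hk : MemLp (fun y : R d => gradKernel x j (point y 0)) 2 volume,
            Integrable (g.pairIntegrand hk)) ∧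
        MemLp (gradSingleLayerFlat g) 2 (volume.restrict (halfSpace d)) ∧
        eLpNorm (gradSingleLayerFlat g) 2 (volume.restrict (halfSpace d)) =
          ENNReal.ofReal (C * g.norm) := by
  have hd0 : 0 < d := by omega
  obtain ⟨c, hc, H⟩ := exists_pairIntegrand_ae_eq hd
  refine ⟨c * √(2 * Real.pi), by positivity, fun g => ?_⟩
  have hH : MeasurableSet (halfSpace d) :=
    (isOpen_lt continuous_const continuous_vertical).measurableSet
  set N : ℝ → Fin (d + 1) → R d → ℂ := fun t j ξ =>
    (c : ℂ) * waveSymbol (EuclideanSpace.single j (1 : ℝ)) ξ *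
        ((Real.exp (-(2 * Real.pi * t) * ‖ξ‖) : ℂ) * g.fourier ξ) with hN
  -- The horizontal position enters only through a unimodular character; hence the pairing is an
  -- inverse Fourier transform evaluated at `x'`, with profile depending on the height alone.
  have hNw : ∀ (x : R (d + 1)) (j : Fin (d + 1)) (ξ : R d), g.fourier ξ * ((c : ℂ) *
      (waveSymbol (EuclideanSpace.single j (1 : ℝ)) ξ * poissonWave x ξ)) =
      Complex.exp (((2 * Real.pi * inner ℝ ξ (horizontal x) : ℝ) : ℂ) * Complex.I) •
        N (vertical x) j ξ := by
    intro x j ξ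
    simp only [hN, poissonWave_eq, smul_eq_mul]
    rw [show (2 * Real.pi * Complex.I * (inner ℝ ξ (horizontal x) : ℝ) : ℂ) =
      ((2 * Real.pi * inner ℝ ξ (horizontal x) : ℝ) : ℂ) * Complex.I by push_cast; ring]
    ring
  have hval : ∀ x ∈ halfSpace d, ∀ j, gradSingleLayerFlat g x j =
      𝓕⁻ (N (vertical x) j) (horizontal x) := by
    intro x hx j
    obtain ⟨hk, h⟩ := H x hx j
    simp only [gradSingleLayerFlat, dif_pos hk]
    rw [integral_congr_ae (h g), Real.fourierInv_eq']
    simp only [hNw]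
  -- The function `ĝ` is only almost everywhere strongly measurable. A strongly measurable version
  -- leaves every integral unchanged and makes the integrand jointly measurable in `(x, ξ)`.
  set G : R d → ℂ := g.locallyIntegrable.aestronglyMeasurable.mk g.fourier with hG
  have hGs : StronglyMeasurable G := g.locallyIntegrable.aestronglyMeasurable.stronglyMeasurable_mk
  set F : R (d + 1) → EuclideanSpace ℂ (Fin (d + 1)) := fun x => WithLp.toLp 2 fun j =>
    ∫ ξ : R d, G ξ * ((c : ℂ) *
      (waveSymbol (EuclideanSpace.single j (1 : ℝ)) ξ * poissonWave x ξ)) with hF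
  have hFm : Measurable F := by
    refine (PiLp.continuous_toLp 2 _).measurable.comp (measurable_pi_lambda _ fun j => ?_)
    refine (StronglyMeasurable.integral_prod_right (f := fun (x : R (d + 1)) (ξ : R d) =>
      G ξ * ((c : ℂ) *
        (waveSymbol (EuclideanSpace.single j (1 : ℝ)) ξ * poissonWave x ξ))) ?_).measurable
    have h1 : Measurable fun p : R (d + 1) × R d => poissonWave p.1 p.2 :=
      continuous_poissonWave.measurable
    exact ((hGs.measurable.comp measurable_snd).mul
      ((((measurable_waveSymbol _).comp measurable_snd).mul h1).const_mul _)).stronglyMeasurable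
  have hFeq : ∀ x ∈ halfSpace d, gradSingleLayerFlat g x = F x := by
    intro x hx
    ext j
    obtain ⟨hk, h⟩ := H x hx j
    simp only [gradSingleLayerFlat, dif_pos hk, hF]
    refine integral_congr_ae ?_
    filter_upwards [h g, g.locallyIntegrable.aestronglyMeasurable.ae_eq_mk] with ξ h1 h2
    rw [h1, h2]
  have hae : gradSingleLayerFlat g =ᵐ[volume.restrict (halfSpace d)] F := by
    filter_upwards [ae_restrict_mem hH] with x hx using hFeq x hx
  have hnorm : eLpNorm (gradSingleLayerFlat g) 2 (volume.restrict (halfSpace d)) =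
      ENNReal.ofReal (c * √(2 * Real.pi) * g.norm) := by
    refine (ENNReal.pow_right_strictMono two_ne_zero).injective ?_
    rw [← g.lintegral_symbol hd0 hc, eLpNorm_congr_ae hae, eLpNorm_two_sq,
      lintegral_halfSpace (hFm.enorm.pow_const 2)]
    refine setLIntegral_congr_fun measurableSet_Ioi fun t ht => ?_
    have ht0 : 0 < t := ht
    have hmem : ∀ y : R d, point y t ∈ halfSpace d := fun y => by simpa [halfSpace] using ht0
    have e1 : ∀ y : R d, ‖F (point y t)‖ₑ ^ 2 = ∑ j, ‖𝓕⁻ (N t j) y‖ₑ ^ 2 := by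
      intro y
      rw [← hFeq _ (hmem y), enorm_sq_eq_sum]
      refine Finset.sum_congr rfl fun j _ => ?_
      rw [hval _ (hmem y), horizontal_point, vertical_point]
    simp only [e1]
    have hcont : ∀ j, Continuous (𝓕⁻ (N t j) : R d → ℂ) := fun j => by
      rw [show (𝓕⁻ (N t j) : R d → ℂ) = 𝓕 (N t j) ∘ Neg.neg from
        funext fun x => Real.fourierInv_eq_fourier_neg _ x]
      exact (VectorFourier.fourierIntegral_continuous Real.continuous_fourierChar continuous_inner
        (g.integrable_and_memLp_symbol hd0 (c : ℂ) ht0 j).1).comp continuous_neg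
    rw [lintegral_finsetSum _ fun j _ => ((hcont j).measurable.enorm.pow_const 2)]
    refine Finset.sum_congr rfl fun j _ => ?_
    obtain ⟨h1, h2⟩ := g.integrable_and_memLp_symbol hd0 (c : ℂ) ht0 j
    rw [← eLpNorm_two_sq, ← eLpNorm_two_sq, eLpNorm_fourierInv h1 h2]
  refine ⟨fun x hx j => ?_, ⟨(hFm.aestronglyMeasurable.congr hae.symm),
    hnorm.trans_lt ENNReal.ofReal_lt_top⟩, hnorm⟩
  obtain ⟨hk, h⟩ := H x hx j
  refine ⟨hk, Integrable.congr ?_ (h g).symm⟩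
  have h1 := (g.integrable_and_memLp_symbol hd0 (c : ℂ) hx j).1
  refine h1.mono ?_ (Filter.Eventually.of_forall fun ξ => ?_)
  · simp only [hNw]
    exact (Continuous.aestronglyMeasurable (f := fun ξ : R d =>
      Complex.exp (((2 * Real.pi * inner ℝ ξ (horizontal x) : ℝ) : ℂ) * Complex.I))
      (by fun_prop)).smul h1.1
  · rw [hNw, norm_smul, Complex.norm_exp_ofReal_mul_I, one_mul]

end

theorem mainTheorem7 (d : ℕ) (hd : 3 ≤ d + 1) :
    (∃ C : ℝ, 0 < C ∧
      ∀ h : R d → ℝ, ContDiff ℝ 2 h → HasCompactSupport h → h ≠ 0 →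
      ∀ ρ₀ : ℝ, 0 < ρ₀ →
      ∀ g : LinftyHMinusHalf h,
        (∀ x ∉ boundary h, ∀ j, gradKernel x j ∈ hHalfSubmodule h) ∧
        volume (boundary h) = 0 ∧
        MemLp (gradSingleLayer g) 2 volume ∧
        eLpNorm (gradSingleLayer g) 2 volume ≤ ENNReal.ofReal (C * layerConst h ρ₀ * g.norm)) ∧
    (∃ C : ℝ, 0 < C ∧
      ∀ g : HomSobolev d (-(1 / 2)),
        (∀ x ∈ halfSpace d, ∀ j,
          ∃ hk : MemLp (fun y : R d => gradKernel x j (point y 0)) 2 volume,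
            Integrable (g.pairIntegrand hk)) ∧
        MemLp (gradSingleLayerFlat g) 2 (volume.restrict (halfSpace d)) ∧
        eLpNorm (gradSingleLayerFlat g) 2 (volume.restrict (halfSpace d)) =
          ENNReal.ofReal (C * g.norm)) := by
  have hd2 : 2 ≤ d := by omega
  refine ⟨?_, halfSpace_identity hd2⟩
  obtain ⟨C, hC, H⟩ := perturbedHalfSpace_estimate hd2
  refine ⟨C, hC, fun h hh hc _ ρ₀ hρ g => ?_⟩
  obtain ⟨h1, h2⟩ := H h hh hc g
  refine ⟨fun x hx j => gradKernel_mem_hHalfSubmodule hd2 hh hc hx j,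
    volume_boundary hh.continuous, h1, h2.trans (ENNReal.ofReal_le_ofReal ?_)⟩
  -- The bound with `Cs h ^ (d + 1)` and the dual norm implies the stated one, since `layerConst`
  -- and the maximum norm are larger.
  have h3 := Cs_pow_le_layerConst h hρ
  have h4 : 0 ≤ Cs h ^ (d + 1) := by
    have := one_le_Cs h
    positivity
  have h5 : ‖g.toDual‖ ≤ g.norm := le_max_right _ _
  have h6 := h4.trans h3
  gcongr
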